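/- **Setting.** Let $\mathrm G$ be a connected undirected graph on $\{1,\dots,n\}$ with symmetric weights $a_{ij}=a_{ji}$, where $a_{ij}>0$ if $\{i,j\}$ is an edge and $a_{ij}=0$ otherwise. Let $\mathbf L$ be its Laplacian matrix, with $\mathbf L_{ij}=-a_{ij}$ for $i\ne j$ and $\mathbf L_{ii}=\sum_j a_{ij}$, and with eigenvalues $0=\lambda_1<\lambda_2\le\dots\le\lambda_n$. Let $\mathbf S\in\mathbb R^{n\times(n-1)}$ have as columns eigenvectors for $\lambda_2,\dots,\lambda_n$, with $\mathbf S^T\mathbf 1_n=0$ and $\mathbf I_n=\mathbf S\mathbf S^T+\mathbf 1_n\mathbf 1_n^T/n$. Put $\mathbf S_\otimes=\mathbf S\otimes\mathbf I_d$ and $\Lambda=\mathrm{diag}(\lambda_2,\dots,\lambda_n)\otimes\mathbf I_d$. Let $f_1,\dots,f_n:\mathbb R^d\to\mathbb R$ be differentiable functions with globally Lipschitz gradients whose sum $f=\sum_i f_i$ is strongly convex, i.e. for some $\mu>0$, $f(x')\ge f(x)+\nabla f(x)^T(x'-x)+\frac\mu2\|x'-x\|^2$ for all $x,x'$. The individual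 $f_i$ need not be convex. A map $\mathbf C:\mathbb R^d\times\mathbb R_+\to\mathbb R^d$, Lebesgue measurable in $t$, is a *strong spatio-temporal (SST) compressor* if for every $k>0$ the origin is a uniformly globally exponentially stable equilibrium of $\dot x=-k\mathbf C(x,t)$ (for some $K,a>0$, every solution on $[t_0,\infty)$, $t_0\ge0$, satisfies $\|x(t)\|\le K\|x(t_0)\|e^{-a(t-t_0)}$ for all $t\ge t_0$), and for some $L_c>0$, $\|\mathbf C(x,t)-\mathbf C(x',t)\|\le L_c\|x-x'\|$ for all $x,x'$ and all $t\ge 0$. Write $\mathcal C(\mathbf x,t)=(\mathbf C(x_1,t),\dots,\mathbf C(x_n,t))$ for $\mathbf x\in\mathbb R^{nd}$ and $\overline{\mathcal C}(\mathbf y,t)=(\mathbf C(y_1,t),\dots,\mathbf C(y_{n-1},t))$ for $\mathbf y\in\mathbb R^{(n-1)d}$. For $\delta>0$ consider the condition $$\|\overline{\mathcal C}(\mathbf S_\otimes^T\mathbf x,t)-\mathbf S_\otimes^T\mathcal C(\mathbf x,t)\|\le\delta\|\mathbf S_\otimes^T\mathbf x\|\qquad\text{for all }(\mathbf x,t)\in\mathbb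 R^{nd}\times\mathbb R_+ .\tag{$*$}$$ For gains $\beta,\eta>0$ consider the primal-dual flow with direct compression $$\dot x_i=-\sum_{j=1}^n\mathbf L_{ij}\mathbf C(x_j,t)-\beta v_i-\eta\nabla f_i(x_i),\qquad \dot v_i=\beta\sum_{j=1}^n\mathbf L_{ij}\mathbf C(x_j,t),\qquad \sum_{i=1}^n v_i(0)=0 .$$ Solutions of differential equations are understood in the sense of Carathéodory, i.e. as solutions of the integral equation. **Theorem.** Let $\mathbf C$ be an SST compressor that satisfies $(*)$ with a sufficiently small $\delta>0$. Then the problem of minimizing $\sum_i f_i(x_i)$ subject to $x_1=\dots=x_n$ has a unique solution $x_1=\dots=x_n=s^*$, and there are $\beta,\eta,\gamma>0$ such that the flow has a global solution from every initial state with $\sum_iv_i(0)=0$, and along every such solution $\|x_i(t)-s^*\|^2=\mathcal O(e^{-\gamma t})$ for every $i$. Here "sufficiently small" can be taken in each of the following two senses. 1. $\delta c_4\lambda_n<c_3$ (that is, $\delta<\frac{c_3}{c_4\lambda_n}$ when $n\ge2$), where $V:\mathbb R^{(n-1)d}\times\mathbb R_+\to\mathbb R$ is any continuously differentiable Lyapunov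 function of the system $\dot{\mathbf y}=-\Lambda\overline{\mathcal C}(\mathbf y,t)$ with constants $c_1,\dots,c_4>0$, i.e. $c_1\|\mathbf y\|^2\le V\le c_2\|\mathbf y\|^2$, $\frac{\partial V}{\partial t}-\frac{\partial V}{\partial\mathbf y}\Lambda\overline{\mathcal C}(\mathbf y,t)\le-c_3\|\mathbf y\|^2$ and $\|\frac{\partial V}{\partial\mathbf y}\|\le c_4\|\mathbf y\|$. 2. $\delta<\delta_0$, where $\delta_0>0$ depends only on $d$, on the weighted graph and $\mathbf S$, on a Lipschitz constant $L_c$ of $\mathbf C$, and on constants $K,a$ that are valid in the exponential stability of all the systems $\dot x=-\lambda_k\mathbf C(x,t)$, $k=2,\dots,n$; no Lyapunov function is assumed. -/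

import Mathlib

open Set Filter MeasureTheory Asymptotics
open scoped BigOperators

noncomputable section

/-- The space `ℝ^d` with its Euclidean norm. -/
abbrev Vec (d : ℕ) : Type := EuclideanSpace ℝ (Fin d)

/-- The space `ℝ^{md}` of `m` stacked vectors of `ℝ^d`, with its Euclidean norm
`‖y‖² = ∑ k, ‖y k‖²`. -/
abbrev Stack (m d : ℕ) : Type := PiLp 2 (fun _ : Fin m => Vec d)

/-! ### The communication graph -/

/-- `w` is a symmetric weight matrix of the undirected graph `G`: the entry `w i j` is positive
on the edges of `G` and zero elsewhere (in particular on the diagonal). -/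
structure IsWeightMatrix {n : ℕ} (G : SimpleGraph (Fin n)) (w : Matrix (Fin n) (Fin n) ℝ) :
    Prop where
  symm : ∀ i j, w i j = w j i
  pos : ∀ i j, G.Adj i j → 0 < w i j
  zero : ∀ i j, ¬ G.Adj i j → w i j = 0

/-- The Laplacian matrix of a weight matrix. -/
def laplacian {n : ℕ} (w : Matrix (Fin n) (Fin n) ℝ) : Matrix (Fin n) (Fin n) ℝ :=
  Matrix.of fun i j => if i = j then ∑ k, w i k else - w i j

/-- The columns of `S` are eigenvectors of `L`, for the eigenvalues `lam` listed in ascending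
order, and `Sᵀ 1 = 0`, `I = S Sᵀ + 1 1ᵀ / n`.  When `L` is the Laplacian of a connected graph,
`lam` lists the nonzero eigenvalues `λ₂ ≤ ⋯ ≤ λₙ` of `L`. -/
structure IsLaplacianEigenbasis {n : ℕ} (L : Matrix (Fin n) (Fin n) ℝ)
    (S : Matrix (Fin n) (Fin (n - 1)) ℝ) (lam : Fin (n - 1) → ℝ) : Prop where
  mono : Monotone lam
  eigen : L * S = S * Matrix.diagonal lam
  orth : S.transpose.mulVec (fun _ => 1) = 0
  complete : (1 : Matrix (Fin n) (Fin n) ℝ) =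
    S * S.transpose + Matrix.of (fun _ _ => 1 / (n : ℝ))

/-- The largest Laplacian eigenvalue `λₙ` (it is `0` for a graph with a single vertex). -/
def lamMax {m : ℕ} (lam : Fin m → ℝ) : ℝ := ⨆ k, lam k

/-! ### Trajectories and exponential stability -/

/-- `y` is a (Carathéodory) solution on `[t₀, ∞)` of the differential equation
`y' = F(t, y)`: it satisfies the integral equation.  When `t ↦ F t (y t)` is continuous this
means that `y` is continuously differentiable with derivative `F t (y t)`. -/
def IsTrajectory {X : Type*} [NormedAddCommGroup X] [NormedSpace ℝ X]
    (F : ℝ → X → X) (t₀ : ℝ) (y : ℝ → X) : Prop :=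
  ContinuousOn y (Ici t₀) ∧
    ∀ t, t₀ ≤ t → IntervalIntegrable (fun s => F s (y s)) volume t₀ t ∧
      y t = y t₀ + ∫ s in t₀..t, F s (y s)

/-- The origin is an equilibrium of `y' = F(t, y)`, `t ≥ 0`, and it is uniformly globally
exponentially stable with constants `K` and `a`. -/
def IsUGESWith {X : Type*} [NormedAddCommGroup X] [NormedSpace ℝ X]
    (F : ℝ → X → X) (K a : ℝ) : Prop :=
  (∀ t, 0 ≤ t → F t 0 = 0) ∧
    ∀ t₀, 0 ≤ t₀ → ∀ y : ℝ → X, IsTrajectory F t₀ y →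
      ∀ t, t₀ ≤ t → ‖y t‖ ≤ K * ‖y t₀‖ * Real.exp (-a * (t - t₀))

/-- Uniform global exponential stability of the origin. -/
def IsUGES {X : Type*} [NormedAddCommGroup X] [NormedSpace ℝ X] (F : ℝ → X → X) : Prop :=
  ∃ K > 0, ∃ a > 0, IsUGESWith F K a

/-! ### Compressors

A compressor is a map `C : ℝ^d × ℝ₊ → ℝ^d`, written `C x t`; only its values at times `t ≥ 0`
are ever used. -/

/-- `C` is Lipschitz in space with constant `Lc`, uniformly in time. -/
def IsLipschitzInSpace {d : ℕ} (C : Vec d → ℝ → Vec d) (Lc : ℝ) : Prop :=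
  ∀ x x' t, 0 ≤ t → ‖C x t - C x' t‖ ≤ Lc * ‖x - x'‖

/-- Strong spatio-temporal compressor: for every `k > 0` the system `x' = -k C(x, t)` is
uniformly globally exponentially stable, and `C` is uniformly globally Lipschitz.  Lebesgue
measurability in time is what makes the differential equations meaningful. -/
structure IsSST {d : ℕ} (C : Vec d → ℝ → Vec d) : Prop where
  meas : ∀ x, AEMeasurable (C x) (volume.restrict (Ici (0 : ℝ)))
  uges : ∀ k : ℝ, 0 < k → IsUGES (fun t x => -(k • C x t))
  lip : ∃ Lc > 0, IsLipschitzInSpace C Lc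

/-- `(Sᵀ ⊗ I_d) x` for a stacked vector `x = (x₁, …, xₙ)`. -/
def projS {n m d : ℕ} (S : Matrix (Fin n) (Fin m) ℝ) (x : Fin n → Vec d) : Stack m d :=
  WithLp.toLp 2 fun k => ∑ i, S i k • x i

/-- `C̄(y, t)`: the compressor applied to every block of `y`. -/
def blockC {m d : ℕ} (C : Vec d → ℝ → Vec d) (y : Stack m d) (t : ℝ) : Stack m d :=
  WithLp.toLp 2 fun k => C (y k) t

/-- `‖C̄((Sᵀ ⊗ I) x, t) - (Sᵀ ⊗ I) 𝒞(x, t)‖ ≤ δ ‖(Sᵀ ⊗ I) x‖` for all `x` and all `t ≥ 0`. -/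
def AlmostCommutes {n m d : ℕ} (C : Vec d → ℝ → Vec d) (S : Matrix (Fin n) (Fin m) ℝ)
    (δ : ℝ) : Prop :=
  ∀ (x : Fin n → Vec d) (t : ℝ), 0 ≤ t →
    ‖blockC C (projS S x) t - projS S (fun i => C (x i) t)‖ ≤ δ * ‖projS S x‖

/-- `Λ C̄(y, t)` with `Λ = diag(lam) ⊗ I_d`. -/
def scaledBlockC {m d : ℕ} (lam : Fin m → ℝ) (C : Vec d → ℝ → Vec d) (y : Stack m d) (t : ℝ) :
    Stack m d :=
  WithLp.toLp 2 fun k => lam k • C (y k) t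

/-- `V` is a continuously differentiable Lyapunov function of quadratic type for the system
`y' = -Λ C̄(y, t)`, `t ≥ 0`, with constants `c₁, c₂, c₃, c₄ > 0`. -/
structure IsLyapunov {m d : ℕ} (lam : Fin m → ℝ) (C : Vec d → ℝ → Vec d)
    (V : Stack m d → ℝ → ℝ) (c₁ c₂ c₃ c₄ : ℝ) : Prop where
  pos : 0 < c₁ ∧ 0 < c₂ ∧ 0 < c₃ ∧ 0 < c₄
  smooth : ContDiffOn ℝ 1 (fun p : Stack m d × ℝ => V p.1 p.2) (univ ×ˢ Ici 0)
  lower : ∀ y t, 0 ≤ t → c₁ * ‖y‖ ^ 2 ≤ V y t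
  upper : ∀ y t, 0 ≤ t → V y t ≤ c₂ * ‖y‖ ^ 2
  decay : ∀ y t, 0 ≤ t →
    derivWithin (V y) (Ici 0) t - fderiv ℝ (fun z => V z t) y (scaledBlockC lam C y t)
      ≤ -c₃ * ‖y‖ ^ 2
  grad : ∀ y t, 0 ≤ t → ‖fderiv ℝ (fun z => V z t) y‖ ≤ c₄ * ‖y‖

/-! ### The optimization problem and the flow -/

/-- The global objective is strongly convex and the local gradients are globally Lipschitz.
The local objectives need not be convex. -/
structure IsAdmissibleObjective {n d : ℕ} (f : Fin n → Vec d → ℝ) : Prop where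
  diff : ∀ i, Differentiable ℝ (f i)
  strong : ∃ μ > 0, ∀ x x' : Vec d,
    ∑ i, f i x + inner ℝ (gradient (fun z => ∑ i, f i z) x) (x' - x) + μ / 2 * ‖x' - x‖ ^ 2
      ≤ ∑ i, f i x'
  lipGrad : ∃ Lf > 0, ∀ i, ∀ x x' : Vec d,
    ‖gradient (f i) x - gradient (f i) x'‖ ≤ Lf * ‖x - x'‖

/-- `s` solves the problem: the consensual point `(s, …, s)` minimizes `∑ i, f i (x i)` subject
to `x i = x j` for all `i, j`. -/
def IsOptimal {n d : ℕ} (f : Fin n → Vec d → ℝ) (s : Vec d) : Prop :=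
  IsMinOn (fun x : Fin n → Vec d => ∑ i, f i (x i)) {x | ∀ i j, x i = x j} (fun _ => s)

/-- Right-hand side of the primal-dual flow with direct compression, in the state
`(x, v) = ((x₁, …, xₙ), (v₁, …, vₙ))`. -/
def primalDualField {n d : ℕ} (L : Matrix (Fin n) (Fin n) ℝ) (f : Fin n → Vec d → ℝ)
    (C : Vec d → ℝ → Vec d) (β η : ℝ) (t : ℝ) (p : (Fin n → Vec d) × (Fin n → Vec d)) :
    (Fin n → Vec d) × (Fin n → Vec d) :=
  (fun i => -(∑ j, L i j • C (p.1 j) t) - β • p.2 i - η • gradient (f i) (p.1 i),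
   fun i => β • ∑ j, L i j • C (p.1 j) t)

/-- With gains `β, η`, the flow has a global solution from every initial state with
`∑ i, vᵢ(0) = 0`, and along every such solution `‖xᵢ(t) - s‖² = O(e^{-γ t})` for every `i`. -/
def FlowConverges {n d : ℕ} (L : Matrix (Fin n) (Fin n) ℝ) (f : Fin n → Vec d → ℝ)
    (C : Vec d → ℝ → Vec d) (β η γ : ℝ) (s : Vec d) : Prop :=
  (∀ x₀ v₀ : Fin n → Vec d, ∑ i, v₀ i = 0 →
    ∃ y, IsTrajectory (primalDualField L f C β η) 0 y ∧ y 0 = (x₀, v₀)) ∧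
  ∀ y : ℝ → (Fin n → Vec d) × (Fin n → Vec d),
    IsTrajectory (primalDualField L f C β η) 0 y → ∑ i, (y 0).2 i = 0 →
      ∀ i, (fun t => ‖(y t).1 i - s‖ ^ 2) =O[atTop] (fun t => Real.exp (-γ * t))

/-- The problem has exactly one solution `s`, and for some gains `β, η > 0` and some rate
`γ > 0` the flow converges exponentially to `s`. -/
def SolvedByFlow {n d : ℕ} (L : Matrix (Fin n) (Fin n) ℝ) (f : Fin n → Vec d → ℝ)
    (C : Vec d → ℝ → Vec d) : Prop :=
  ∃ s : Vec d, (∀ s', IsOptimal f s' ↔ s' = s) ∧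
    ∃ β > 0, ∃ η > 0, ∃ γ > 0, FlowConverges L f C β η γ s

end

/-!
Write `y = Sᵀ x` for the disagreement of the agents, `e` for the error of their mean, and `v*` for
the dual equilibrium, which is `-(η/β) ∇fᵢ(s*)` at agent `i`. Since `Sᵀ L = Λ Sᵀ`, `AlmostCommutes` says
that `y' = -Λ C̄(y, t)` up to a relative perturbation of size `λₙ δ` and up to terms with small gains.
The compressor drops out of the velocity of `q = Sᵀ (v - v*) + β y`, and of that of `e` because the
columns of `L` sum to zero. With `η = β²` this leaves

* `y' = -Λ C̄(y, t) + O(λₙ δ ‖y‖) + O(β ‖q‖ + β² (‖y‖ + ‖e‖))`,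
* `q' = -β² q + O(β³ (‖y‖ + ‖e‖))`,
* `e' = -(β²/n) ∑ ∇fᵢ(s* + e) + O(β² ‖y‖)`, where the first term is strongly monotone in `e`.

The constants are uniform in `β`: `e` is controlled by `y`, and `q` by `β y`, so that the gain of the
feedback loop around `y` is `O(β²)`. Once the `y`-system is exponentially stable in a way that tolerates
the `λₙ δ` term (`IsRobustlyStable`), a small `β` closes the loop (`smallGain`,
`solvedByFlow_of_isRobustlyStable`).

Robust stability is where the two thresholds differ. With a Lyapunov function it follows by
differentiating `V` along the (only absolutely continuous) solution almost everywhere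
(`exists_isRobustlyStable_of_lyapunov`); this costs exactly `λₙ δ c₄ < c₃`. Without one, no Lyapunov
function is constructed: a perturbed solution is compared, over windows of a fixed length in which the
nominal system contracts by `1/4`, with the nominal solution from the same point
(`exists_robustness_margin`). This comparison, and the global existence claim for the flow, rest on
an existence theorem for Carathéodory equations that are Lipschitz in space (`exists_isTrajectory`).
-/

/-! ### Trajectories and their velocities -/

section Trajectories

variable {X Y : Type*} [NormedAddCommGroup X] [NormedSpace ℝ X]
  [NormedAddCommGroup Y] [NormedSpace ℝ Y]

theorem IsTrajectory.congr {F F' : ℝ → X → X} {t₀ : ℝ} {y : ℝ → X}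
    (hy : IsTrajectory F t₀ y) (h : ∀ s, t₀ ≤ s → F s (y s) = F' s (y s)) :
    IsTrajectory F' t₀ y := by
  refine ⟨hy.1, fun t ht => ?_⟩
  obtain ⟨h1, h2⟩ := hy.2 t ht
  have e : EqOn (fun s => F s (y s)) (fun s => F' s (y s)) (uIcc t₀ t) := by
    intro s hs
    rw [uIcc_of_le ht] at hs
    exact h s hs.1
  refine ⟨h1.congr (fun s hs => e (uIoc_subset_uIcc hs)), ?_⟩
  rw [h2, intervalIntegral.integral_congr e]

/-- A continuous linear map carries a trajectory to a primitive of the image of its velocity. -/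
theorem IsTrajectory.clm_comp [CompleteSpace X] [CompleteSpace Y] (A : X →L[ℝ] Y)
    {F : ℝ → X → X} {t₀ : ℝ} {y : ℝ → X} (hy : IsTrajectory F t₀ y) :
    IsTrajectory (fun s _ => A (F s (y s))) t₀ (fun s => A (y s)) := by
  refine ⟨A.continuous.comp_continuousOn hy.1, fun t ht => ?_⟩
  obtain ⟨h1, h2⟩ := hy.2 t ht
  refine ⟨⟨A.integrable_comp h1.1, A.integrable_comp h1.2⟩, ?_⟩
  rw [A.intervalIntegral_comp_comm h1]
  have h3 := congrArg A h2
  rwa [map_add] at h3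

theorem IsTrajectory.sub_eq_integral {h : ℝ → X} {t₀ : ℝ} {y : ℝ → X}
    (hy : IsTrajectory (fun s _ => h s) t₀ y) {a b : ℝ} (ha : t₀ ≤ a) (hab : a ≤ b) :
    IntervalIntegrable h volume a b ∧ y b - y a = ∫ s in a..b, h s := by
  obtain ⟨h1, h2⟩ := hy.2 a ha
  obtain ⟨h3, h4⟩ := hy.2 b (ha.trans hab)
  refine ⟨h1.symm.trans h3, ?_⟩
  rw [h2, h4, ← intervalIntegral.integral_interval_sub_left h3 h1]
  abel

theorem IsTrajectory.lipschitzOnWith {h : ℝ → X} {t₀ T B : ℝ} {y : ℝ → X}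
    (hy : IsTrajectory (fun s _ => h s) t₀ y) (hB : ∀ s ∈ Icc t₀ T, ‖h s‖ ≤ B) :
    LipschitzOnWith B.toNNReal y (Icc t₀ T) := by
  have key : ∀ a ∈ Icc t₀ T, ∀ b ∈ Icc t₀ T, a ≤ b → ‖y b - y a‖ ≤ B * |b - a| := by
    intro a ha b hb hab
    rw [(hy.sub_eq_integral ha.1 hab).2]
    refine intervalIntegral.norm_integral_le_of_norm_le_const fun s hs => ?_
    rw [uIoc_of_le hab] at hs
    exact hB s ⟨ha.1.trans hs.1.le, hs.2.trans hb.2⟩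
  have hB0 : ∀ a ∈ Icc t₀ T, 0 ≤ B := fun a ha => (norm_nonneg _).trans (hB a ha)
  refine LipschitzOnWith.of_dist_le_mul fun a ha b hb => ?_
  rw [Real.coe_toNNReal _ (hB0 a ha), Real.dist_eq, dist_eq_norm]
  rcases le_total a b with hab | hab
  · rw [norm_sub_rev, abs_sub_comm]
    exact key a ha b hb hab
  · exact key b hb a ha hab

theorem IsTrajectory.ae_hasDerivAt [CompleteSpace X] {h : ℝ → X} {T : ℝ} {y : ℝ → X}
    (hy : IsTrajectory (fun s _ => h s) 0 y) :
    ∀ᵐ t, t ∈ Ioo 0 T → HasDerivAt y (h t) t := by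
  rcases le_or_gt T 0 with hT | hT
  · exact Eventually.of_forall fun t ht => absurd (ht.1.trans ht.2) (not_lt.2 hT)
  filter_upwards [(hy.2 T hT.le).1.ae_hasDerivAt_integral] with t ht htm
  have h1 := ht (by rw [uIcc_of_le hT.le]; exact Ioo_subset_Icc_self htm) 0
    (by rw [uIcc_of_le hT.le]; exact ⟨le_rfl, hT.le⟩)
  refine (h1.const_add (y 0)).congr_of_eventuallyEq ?_
  filter_upwards [Ioi_mem_nhds htm.1] with s hs
  exact (hy.2 s (le_of_lt hs)).2

end Trajectories

/-! ### Differential inequalities almost everywhere -/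

section Comparison

/-- An absolutely continuous function whose derivative is almost everywhere nonpositive does not
increase. -/
theorem AbsolutelyContinuousOnInterval.le_of_ae_deriv_nonpos {v : ℝ → ℝ} {T : ℝ} (hT : 0 ≤ T)
    (hv : AbsolutelyContinuousOnInterval v 0 T) (h : ∀ᵐ t, t ∈ Ioo 0 T → deriv v t ≤ 0) :
    v T ≤ v 0 := by
  have h1 := hv.integral_deriv_eq_sub
  have h2 : ∫ t in (0 : ℝ)..T, deriv v t ≤ 0 := by
    rw [intervalIntegral.integral_of_le hT, integral_Ioc_eq_integral_Ioo]
    exact integral_nonpos_of_ae ((ae_restrict_iff' measurableSet_Ioo).2 h)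
  linarith

/-- Exponential decay from the differential inequality `v' ≤ -κ v + b e^{-2γ t}` with
`4 γ ≤ κ`. -/
theorem le_exp_of_ae_deriv_le {v : ℝ → ℝ} {T κ b γ : ℝ} (hT : 0 ≤ T)
    (hv : AbsolutelyContinuousOnInterval v 0 T) (hv0 : 0 ≤ v 0) (hκ : 0 < κ) (hγ : 4 * γ ≤ κ)
    (hb : 0 ≤ b)
    (hd : ∀ᵐ t, t ∈ Ioo 0 T →
      ∃ v', HasDerivAt v v' t ∧ v' ≤ -κ * v t + b * Real.exp (-(2 * γ) * t)) :
    v T ≤ (v 0 + 2 * b / κ) * Real.exp (-(2 * γ) * T) := by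
  have hk : 0 < κ - 2 * γ := by linarith
  set c := b / (κ - 2 * γ) with hc
  have hE : ContDiffOn ℝ 1 (fun t : ℝ => Real.exp (κ * t)) (uIcc 0 T) := by fun_prop
  have hE' : ContDiffOn ℝ 1 (fun t : ℝ => c * Real.exp ((κ - 2 * γ) * t)) (uIcc 0 T) := by
    fun_prop
  have h1 := (hE.absolutelyContinuousOnInterval.mul hv).sub hE'.absolutelyContinuousOnInterval
  -- with the integrating factor `e^{κ t}`, the function `e^{κ t} v - c e^{(κ - 2γ) t}` is nonincreasing
  have h2 := h1.le_of_ae_deriv_nonpos hT (by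
    filter_upwards [hd] with t ht htm
    obtain ⟨v', hv', hle⟩ := ht htm
    have e1 : HasDerivAt (fun t : ℝ => Real.exp (κ * t)) (Real.exp (κ * t) * (κ * 1)) t :=
      ((hasDerivAt_id t).const_mul κ).exp
    have e2 : HasDerivAt (fun t : ℝ => c * Real.exp ((κ - 2 * γ) * t))
        (c * (Real.exp ((κ - 2 * γ) * t) * ((κ - 2 * γ) * 1))) t :=
      ((hasDerivAt_id t).const_mul (κ - 2 * γ)).exp.const_mul c
    rw [((e1.mul hv').sub e2).deriv]
    have e3 : Real.exp ((κ - 2 * γ) * t) = Real.exp (κ * t) * Real.exp (-(2 * γ) * t) := by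
      rw [← Real.exp_add]; ring_nf
    have e4 : c * (κ - 2 * γ) = b := by rw [hc]; field_simp
    have e5 : Real.exp (κ * t) * (κ * 1) * v t + Real.exp (κ * t) * v' -
        c * (Real.exp ((κ - 2 * γ) * t) * ((κ - 2 * γ) * 1)) =
        Real.exp (κ * t) * (v' - (-κ * v t + b * Real.exp (-(2 * γ) * t))) := by
      rw [e3, ← e4]; ring
    rw [e5]
    exact mul_nonpos_of_nonneg_of_nonpos (Real.exp_pos _).le (by linarith))
  simp only [Pi.sub_apply, Pi.mul_apply, mul_zero, Real.exp_zero, one_mul, mul_one] at h2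
  have hc0 : 0 ≤ c := by positivity
  have hc1 : c ≤ 2 * b / κ := by
    rw [hc, div_le_div_iff₀ hk hκ]
    nlinarith
  have e3 : Real.exp ((κ - 2 * γ) * T) = Real.exp (κ * T) * Real.exp (-(2 * γ) * T) := by
    rw [← Real.exp_add]; ring_nf
  have e6 : 1 ≤ Real.exp ((κ - 2 * γ) * T) := Real.one_le_exp (by positivity)
  have e7 : Real.exp (κ * T) * v T ≤ Real.exp (κ * T) *
      ((v 0 + 2 * b / κ) * Real.exp (-(2 * γ) * T)) := by
    have e8 : Real.exp (κ * T) * ((v 0 + 2 * b / κ) * Real.exp (-(2 * γ) * T)) =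
      (v 0 + 2 * b / κ) * Real.exp ((κ - 2 * γ) * T) := by rw [e3]; ring
    rw [e8]
    nlinarith
  exact le_of_mul_le_mul_left e7 (Real.exp_pos _)

/-- Energy estimate: a curve whose velocity `h` satisfies
`⟨q, h⟩ ≤ -κ ‖q‖² + R e^{-γ t} ‖q‖` decays like `e^{-γ t}` if `4 γ ≤ κ`. -/
theorem IsTrajectory.norm_le_exp {X : Type*} [NormedAddCommGroup X] [InnerProductSpace ℝ X]
    [CompleteSpace X] {q h : ℝ → X} (hq : IsTrajectory (fun s _ => h s) 0 q) {T κ R γ B : ℝ}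
    (hT : 0 ≤ T) (hB : ∀ s ∈ Icc 0 T, ‖h s‖ ≤ B) (hκ : 0 < κ) (hγ : 4 * γ ≤ κ) (hR : 0 ≤ R)
    (hd : ∀ s ∈ Icc 0 T, inner ℝ (q s) (h s) ≤
      -κ * ‖q s‖ ^ 2 + R * Real.exp (-γ * s) * ‖q s‖) :
    ‖q T‖ ≤ (‖q 0‖ + 2 * R / κ) * Real.exp (-γ * T) := by
  have hlip := hq.lipschitzOnWith hB
  have hn : LipschitzOnWith B.toNNReal (fun t => ‖q t‖) (uIcc 0 T) := by
    rw [uIcc_of_le hT]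
    have := lipschitzWith_one_norm.comp_lipschitzOnWith hlip
    rwa [one_mul] at this
  have hac : AbsolutelyContinuousOnInterval (fun t => ‖q t‖ * ‖q t‖) 0 T :=
    hn.absolutelyContinuousOnInterval.mul hn.absolutelyContinuousOnInterval
  have h1 := le_exp_of_ae_deriv_le (κ := κ) (b := R ^ 2 / κ) (γ := γ) hT hac (by positivity) hκ
    hγ (by positivity) (by
      filter_upwards [hq.ae_hasDerivAt (T := T)] with t ht htm
      refine ⟨_, ((ht htm).norm_sq).congr_of_eventuallyEq
        (Eventually.of_forall fun s => (sq _).symm), ?_⟩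
      have h2 := hd t (Ioo_subset_Icc_self htm)
      have e1 : Real.exp (-(2 * γ) * t) = Real.exp (-γ * t) ^ 2 := by
        rw [← Real.exp_nat_mul]; congr 1; push_cast; ring
      rw [e1]
      -- Young's inequality absorbs the cross term into half of the dissipation
      have h3 : 0 ≤ (κ * ‖q t‖ - R * Real.exp (-γ * t)) ^ 2 / κ := by positivity
      have h4 : (κ * ‖q t‖ - R * Real.exp (-γ * t)) ^ 2 / κ = κ * ‖q t‖ ^ 2 -
          2 * (R * Real.exp (-γ * t) * ‖q t‖) + R ^ 2 / κ * Real.exp (-γ * t) ^ 2 := by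
        field_simp
        ring
      nlinarith)
  have e1 : Real.exp (-(2 * γ) * T) = Real.exp (-γ * T) ^ 2 := by
    rw [← Real.exp_nat_mul]; congr 1; push_cast; ring
  refine le_of_sq_le_sq ?_ (by positivity)
  rw [e1] at h1
  rw [mul_pow]
  refine le_trans (by rw [sq]; exact h1) (mul_le_mul_of_nonneg_right ?_ (by positivity))
  have h5 : 2 * (R ^ 2 / κ) / κ = 2 * (R / κ) ^ 2 := by field_simp
  have h6 : 2 * R / κ = 2 * (R / κ) := by ring
  have h7 : 0 ≤ R / κ := by positivity
  rw [h5, h6]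
  nlinarith [norm_nonneg (q 0), mul_nonneg (norm_nonneg (q 0)) h7]

end Comparison

/-! ### Global solutions of Carathéodory equations -/

section Existence

open scoped BoundedContinuousFunction

variable {X : Type*} [NormedAddCommGroup X] [NormedSpace ℝ X]

theorem norm_integral_le_of_norm_le_exp {g : ℝ → X} {t₀ t c ω : ℝ} (hω : 0 < ω) (ht : t₀ ≤ t)
    (hc : 0 ≤ c) (hg : ∀ s, t₀ ≤ s → ‖g s‖ ≤ c * Real.exp (ω * (s - t₀))) :
    ‖∫ s in t₀..t, g s‖ ≤ c / ω * Real.exp (ω * (t - t₀)) := by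
  have hd : ∀ s ∈ uIcc t₀ t, HasDerivAt (fun s => c / ω * Real.exp (ω * (s - t₀)))
      (c * Real.exp (ω * (s - t₀))) s := by
    intro s _
    have h1 : HasDerivAt (fun s => ω * (s - t₀)) (ω * 1) s :=
      ((hasDerivAt_id s).sub_const t₀).const_mul ω
    refine (h1.exp.const_mul (c / ω)).congr_deriv ?_
    field_simp
  have hi : IntervalIntegrable (fun s => c * Real.exp (ω * (s - t₀))) volume t₀ t :=
    Continuous.intervalIntegrable (by fun_prop) _ _
  have h1 := intervalIntegral.norm_integral_le_of_norm_le (μ := volume) ht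
    (Eventually.of_forall fun s hs => hg s hs.1.le) hi
  rw [intervalIntegral.integral_eq_sub_of_hasDerivAt hd hi] at h1
  refine h1.trans ?_
  have : 0 ≤ c / ω := by positivity
  simp [this]

/-- Global existence for Carathéodory equations that are uniformly Lipschitz in space. The proof
applies Banach's fixed point theorem to `u(t) = e^{-2L(t-t₀)} y(t)`: in the exponentially
weighted norm the integral operator is a contraction on the whole half-line. -/
theorem exists_isTrajectory [CompleteSpace X] {F : ℝ → X → X} {t₀ L B : ℝ} (hL : 0 < L)
    (hlip : ∀ t, t₀ ≤ t → ∀ x x', ‖F t x - F t x'‖ ≤ L * ‖x - x'‖)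
    (hB : ∀ t, t₀ ≤ t → ‖F t 0‖ ≤ B)
    (hmeas : ∀ y : ℝ → X, Continuous y →
      AEStronglyMeasurable (fun s => F s (y s)) (volume.restrict (Ici t₀))) (x₀ : X) :
    ∃ y, IsTrajectory F t₀ y ∧ y t₀ = x₀ := by
  set ω := 2 * L with hω
  have hω0 : 0 < ω := by positivity
  have hB0 : 0 ≤ B := (norm_nonneg _).trans (hB t₀ le_rfl)
  -- the rescaled curve and its velocity
  let Y : (ℝ →ᵇ X) → ℝ → X := fun u s => Real.exp (ω * (s - t₀)) • u s
  have hYc : ∀ u, Continuous (Y u) := fun u => by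
    have := u.continuous
    fun_prop
  let G : (ℝ →ᵇ X) → ℝ → X := fun u => (Ici t₀).indicator fun s => F s (Y u s)
  have hGb : ∀ u s, t₀ ≤ s → ‖G u s‖ ≤ (L * ‖u‖ + B) * Real.exp (ω * (s - t₀)) := by
    intro u s hs
    have h1 : (1 : ℝ) ≤ Real.exp (ω * (s - t₀)) :=
      Real.one_le_exp (mul_nonneg hω0.le (sub_nonneg.2 hs))
    have h2 := hlip s hs (Y u s) 0
    rw [sub_zero] at h2
    have h3 : ‖Y u s‖ = Real.exp (ω * (s - t₀)) * ‖u s‖ := by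
      simp [Y, norm_smul]
    have h4 := u.norm_coe_le_norm s
    have h5 : ‖F s (Y u s)‖ ≤ L * ‖Y u s‖ + B := by
      have := norm_add_le (F s (Y u s) - F s 0) (F s 0)
      rw [sub_add_cancel] at this
      linarith [hB s hs]
    simp only [G, indicator_of_mem (show s ∈ Ici t₀ from hs)]
    refine h5.trans ?_
    rw [h3, add_mul, mul_assoc L ‖u‖, mul_comm ‖u‖]
    refine add_le_add (by gcongr) ?_
    nlinarith
  have hGi : ∀ u a b, IntervalIntegrable (G u) volume a b := by
    intro u a b
    have hm : AEStronglyMeasurable (G u) volume :=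
      (aestronglyMeasurable_indicator_iff measurableSet_Ici).2 (hmeas _ (hYc u))
    have hmax : IntervalIntegrable
        (fun s => (L * ‖u‖ + B) * Real.exp (ω * (s - t₀))) volume a b :=
      Continuous.intervalIntegrable (by fun_prop) _ _
    refine hmax.mono_fun hm.restrict (Eventually.of_forall fun s => ?_)
    simp only [Real.norm_of_nonneg (show 0 ≤ (L * ‖u‖ + B) * Real.exp (ω * (s - t₀)) by positivity)]
    rcases le_or_gt t₀ s with hs | hs
    · exact hGb u s hs
    · simp only [G, indicator_of_notMem (show s ∉ Ici t₀ from not_le.2 hs), norm_zero]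
      positivity
  let I : (ℝ →ᵇ X) → ℝ → X := fun u t => ∫ s in t₀..max t t₀, G u s
  have hIc : ∀ u, Continuous (I u) := fun u =>
    (intervalIntegral.continuous_primitive (hGi u) t₀).comp (by fun_prop)
  have hexp : ∀ t, Real.exp (-(ω * (max t t₀ - t₀))) * Real.exp (ω * (max t t₀ - t₀)) = 1 := by
    intro t
    rw [← Real.exp_add, neg_add_cancel, Real.exp_zero]
  have hle1 : ∀ t, Real.exp (-(ω * (max t t₀ - t₀))) ≤ 1 := by
    intro t
    rw [Real.exp_le_one_iff, neg_nonpos]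
    exact mul_nonneg hω0.le (sub_nonneg.2 (le_max_right _ _))
  have hIb : ∀ u t, ‖Real.exp (-(ω * (max t t₀ - t₀))) • (x₀ + I u t)‖ ≤
      ‖x₀‖ + (L * ‖u‖ + B) / ω := by
    intro u t
    have h1 := norm_integral_le_of_norm_le_exp hω0 (le_max_right t t₀) (by positivity) (hGb u)
    rw [norm_smul, Real.norm_of_nonneg (Real.exp_pos _).le]
    calc Real.exp (-(ω * (max t t₀ - t₀))) * ‖x₀ + I u t‖
        ≤ Real.exp (-(ω * (max t t₀ - t₀))) *
          (‖x₀‖ + (L * ‖u‖ + B) / ω * Real.exp (ω * (max t t₀ - t₀))) := by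
          gcongr
          exact (norm_add_le _ _).trans (by gcongr)
      _ = Real.exp (-(ω * (max t t₀ - t₀))) * ‖x₀‖ + (L * ‖u‖ + B) / ω *
          (Real.exp (-(ω * (max t t₀ - t₀))) * Real.exp (ω * (max t t₀ - t₀))) := by ring
      _ ≤ _ := by
          rw [hexp, mul_one]
          have := mul_le_mul_of_nonneg_right (hle1 t) (norm_nonneg x₀)
          linarith
  let Φ : (ℝ →ᵇ X) → (ℝ →ᵇ X) := fun u => BoundedContinuousFunction.ofNormedAddCommGroup
    (fun t => Real.exp (-(ω * (max t t₀ - t₀))) • (x₀ + I u t))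
    (by have := hIc u; fun_prop) (‖x₀‖ + (L * ‖u‖ + B) / ω) (hIb u)
  have hΦ : ContractingWith (1 / 2) Φ := by
    refine ⟨by norm_num [← NNReal.coe_lt_coe], LipschitzWith.of_dist_le_mul fun u w => ?_⟩
    refine (BoundedContinuousFunction.dist_le (by positivity)).2 fun t => ?_
    have hdiff : I u t - I w t = ∫ s in t₀..max t t₀, (G u s - G w s) :=
      (intervalIntegral.integral_sub (hGi _ _ _) (hGi _ _ _)).symm
    have hGd : ∀ s, t₀ ≤ s → ‖G u s - G w s‖ ≤ (L * dist u w) * Real.exp (ω * (s - t₀)) := by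
      intro s hs
      simp only [G, indicator_of_mem (show s ∈ Ici t₀ from hs)]
      refine (hlip s hs _ _).trans ?_
      have h3 : ‖Y u s - Y w s‖ = Real.exp (ω * (s - t₀)) * dist (u s) (w s) := by
        simp only [Y, ← smul_sub, norm_smul, dist_eq_norm]
        rw [Real.norm_of_nonneg (Real.exp_pos _).le]
      have h4 : dist (u s) (w s) ≤ dist u w := BoundedContinuousFunction.dist_coe_le_dist s
      rw [h3, mul_assoc L, mul_comm (dist u w)]
      gcongr
    have h1 := norm_integral_le_of_norm_le_exp hω0 (le_max_right t t₀) (by positivity) hGd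
    have h2 : dist (Φ u t) (Φ w t) =
        Real.exp (-(ω * (max t t₀ - t₀))) * ‖I u t - I w t‖ := by
      simp only [Φ, BoundedContinuousFunction.coe_ofNormedAddCommGroup, dist_eq_norm, ← smul_sub,
        add_sub_add_left_eq_sub, norm_smul]
      rw [Real.norm_of_nonneg (Real.exp_pos _).le]
    rw [h2, hdiff]
    calc _ ≤ Real.exp (-(ω * (max t t₀ - t₀))) *
          (L * dist u w / ω * Real.exp (ω * (max t t₀ - t₀))) := by gcongr
      _ = L * dist u w / ω *
          (Real.exp (-(ω * (max t t₀ - t₀))) * Real.exp (ω * (max t t₀ - t₀))) := by ring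
      _ = _ := by
          rw [hexp, hω]
          push_cast
          field_simp
  obtain ⟨u, hu, -⟩ := hΦ.exists_fixedPoint 0 (edist_ne_top _ _)
  have hyt : ∀ t, t₀ ≤ t → Y u t = x₀ + ∫ s in t₀..t, G u s := by
    intro t ht
    have h1 : u t = Real.exp (-(ω * (max t t₀ - t₀))) • (x₀ + I u t) :=
      (congrArg (fun f : ℝ →ᵇ X => f t) hu).symm
    simp only [Y, I] at h1 ⊢
    have h2 := hexp t
    rw [max_eq_left ht] at h1 h2
    rw [h1, smul_smul, mul_comm, h2, one_smul]
  have hy0 : Y u t₀ = x₀ := by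
    rw [hyt t₀ le_rfl, intervalIntegral.integral_same, add_zero]
  have hGF : ∀ t, t₀ ≤ t → EqOn (G u) (fun s => F s (Y u s)) (uIcc t₀ t) := by
    intro t ht s hs
    rw [uIcc_of_le ht] at hs
    simp only [G, indicator_of_mem (show s ∈ Ici t₀ from hs.1)]
  refine ⟨Y u, ⟨(hYc u).continuousOn, fun t ht => ⟨?_, ?_⟩⟩, hy0⟩
  · exact (hGi u t₀ t).congr fun s hs => hGF t ht (uIoc_subset_uIcc hs)
  · rw [hy0, hyt t ht, intervalIntegral.integral_congr (hGF t ht)]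

end Existence

/-! ### Equations driven by a compressor -/

section Compressor

variable {d : ℕ} {C : Vec d → ℝ → Vec d} {Lc : ℝ}

theorem IsSST.apply_zero (hC : IsSST C) {t : ℝ} (ht : 0 ≤ t) : C 0 t = 0 := by
  obtain ⟨K, -, a, -, h, -⟩ := hC.uges 1 one_pos
  simpa using h t ht

/-- Composing the compressor with a continuous curve gives a measurable function of time: the
curve is a pointwise limit of simple functions, and `C` is continuous in space. -/
theorem aemeasurable_compressor_comp
    (hmeas : ∀ x, AEMeasurable (C x) (volume.restrict (Ici (0 : ℝ))))
    (hlip : IsLipschitzInSpace C Lc) {y : ℝ → Vec d} (hy : Continuous y) :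
    AEMeasurable (fun s => C (y s) s) (volume.restrict (Ici (0 : ℝ))) := by
  have hs := hy.stronglyMeasurable
  have hn : ∀ n, AEMeasurable (fun s => C (hs.approx n s) s) (volume.restrict (Ici (0 : ℝ))) := by
    intro n
    have e : (fun s => C (hs.approx n s) s) = fun s =>
        ∑ x ∈ (hs.approx n).range, ((hs.approx n) ⁻¹' {x}).indicator (C x) s := by
      funext s
      rw [Finset.sum_eq_single (hs.approx n s)]
      · simp
      · intro b _ hb
        exact indicator_of_notMem (fun h => hb (by simpa using h.symm)) _
      · exact fun h => absurd (SimpleFunc.mem_range_self _ s) h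
    rw [e]
    exact Finset.aemeasurable_fun_sum _ fun x _ =>
      (hmeas x).indicator ((hs.approx n).measurableSet_preimage _)
  refine aemeasurable_of_tendsto_metrizable_ae atTop hn ?_
  filter_upwards [ae_restrict_mem measurableSet_Ici] with s hs0
  have h1 := hs.tendsto_approx s
  rw [tendsto_iff_norm_sub_tendsto_zero] at h1 ⊢
  refine squeeze_zero (fun _ => norm_nonneg _) (fun n => hlip _ _ s hs0) ?_
  simpa using h1.const_mul Lc

/-- The scalar-gain systems `x' = -k C(x, t)` have global solutions. -/
theorem IsSST.exists_isTrajectory (hC : IsSST C) (k : ℝ) {t₀ : ℝ} (ht₀ : 0 ≤ t₀) (x₀ : Vec d) :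
    ∃ y, IsTrajectory (fun t x => -(k • C x t)) t₀ y ∧ y t₀ = x₀ := by
  obtain ⟨Lc, hLc, hlip⟩ := hC.lip
  refine _root_.exists_isTrajectory (L := |k| * Lc + 1) (B := 0) (by positivity) ?_ ?_ ?_ x₀
  · intro t ht x x'
    rw [neg_sub_neg, ← smul_sub, norm_smul, Real.norm_eq_abs, norm_sub_rev x x']
    have := mul_le_mul_of_nonneg_left (hlip x' x t (ht₀.trans ht)) (abs_nonneg k)
    nlinarith [norm_nonneg (x' - x)]
  · intro t ht
    simp [hC.apply_zero (ht₀.trans ht)]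
  · intro y hy
    have h1 := (aemeasurable_compressor_comp hC.meas hlip hy).mono_measure
      (Measure.restrict_mono_set volume (Ici_subset_Ici.2 ht₀))
    exact (h1.const_smul k).neg.aestronglyMeasurable

end Compressor

/-! ### The block system `y' = -Λ C̄(y, t)` -/

section BlockSystem

variable {m d : ℕ} {lam : Fin m → ℝ} {C : Vec d → ℝ → Vec d} {Λ Lc : ℝ}

theorem stack_norm_le_of_forall_le {z w : Stack m d} {c : ℝ} (hc : 0 ≤ c)
    (h : ∀ k, ‖z k‖ ≤ c * ‖w k‖) : ‖z‖ ≤ c * ‖w‖ := by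
  refine le_of_sq_le_sq ?_ (by positivity)
  rw [mul_pow, PiLp.norm_sq_eq_of_L2, PiLp.norm_sq_eq_of_L2, Finset.mul_sum]
  refine Finset.sum_le_sum fun k _ => ?_
  rw [← mul_pow]
  exact pow_le_pow_left₀ (norm_nonneg _) (h k) 2

theorem neg_scaledBlockC_lipschitz (hΛ : 0 ≤ Λ) (hlam : ∀ k, |lam k| ≤ Λ) (hLc : 0 ≤ Lc)
    (hlip : IsLipschitzInSpace C Lc) {t : ℝ} (ht : 0 ≤ t) (y y' : Stack m d) :
    ‖-scaledBlockC lam C y t - -scaledBlockC lam C y' t‖ ≤ Λ * Lc * ‖y - y'‖ := by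
  rw [neg_sub_neg, norm_sub_rev]
  refine stack_norm_le_of_forall_le (by positivity) fun k => ?_
  simp only [scaledBlockC, PiLp.sub_apply, ← smul_sub, norm_smul, Real.norm_eq_abs]
  rw [mul_assoc]
  exact mul_le_mul (hlam k) (hlip _ _ t ht) (norm_nonneg _) hΛ

theorem IsSST.scaledBlockC_zero (hC : IsSST C) {t : ℝ} (ht : 0 ≤ t) :
    scaledBlockC lam C 0 t = 0 := by
  ext1 k
  simp [scaledBlockC, hC.apply_zero ht]

/-- Solutions of the block system exist, and they inherit the exponential bound of the scalar-gain
systems `x' = -λₖ C(x, t)` that drive the blocks. -/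
theorem exists_isTrajectory_scaledBlockC (hC : IsSST C) {K a : ℝ} (hK : 0 ≤ K)
    (hU : ∀ k, IsUGESWith (fun t x => -(lam k • C x t)) K a) {t₀ : ℝ} (ht₀ : 0 ≤ t₀)
    (y₀ : Stack m d) :
    ∃ φ, IsTrajectory (fun t y => -scaledBlockC lam C y t) t₀ φ ∧ φ t₀ = y₀ ∧
      ∀ t, t₀ ≤ t → ‖φ t‖ ≤ K * ‖y₀‖ * Real.exp (-a * (t - t₀)) := by
  obtain ⟨Lc, hLc, hlip⟩ := hC.lip
  have hΛ : ∀ k, |lam k| ≤ ∑ k, |lam k| := fun k =>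
    Finset.single_le_sum (f := fun k => |lam k|) (fun _ _ => abs_nonneg _) (Finset.mem_univ k)
  have hΛ0 : 0 ≤ ∑ k, |lam k| := Finset.sum_nonneg fun _ _ => abs_nonneg _
  obtain ⟨φ, hφ, hφ0⟩ := exists_isTrajectory (F := fun t y => -scaledBlockC lam C y t)
    (t₀ := t₀) (L := (∑ k, |lam k|) * Lc + 1) (B := 0) (by positivity)
    (fun t ht x x' => (neg_scaledBlockC_lipschitz hΛ0 hΛ hLc.le hlip (ht₀.trans ht) x x').trans
      (by nlinarith [norm_nonneg (x - x')]))
    (fun t ht => by rw [hC.scaledBlockC_zero (ht₀.trans ht)]; simp)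
    (fun y hy => by
      refine AEMeasurable.aestronglyMeasurable (AEMeasurable.neg ?_)
      refine (WithLp.measurable_toLp 2 _).comp_aemeasurable (aemeasurable_pi_lambda _ fun k => ?_)
      refine AEMeasurable.const_smul ?_ (lam k)
      exact (aemeasurable_compressor_comp hC.meas hlip (by fun_prop)).mono_measure
        (Measure.restrict_mono_set volume (Ici_subset_Ici.2 ht₀))) y₀
  refine ⟨φ, hφ, hφ0, fun t ht => ?_⟩
  have hk : ∀ k, ‖φ t k‖ ≤ K * Real.exp (-a * (t - t₀)) * ‖y₀ k‖ := by
    intro k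
    have h1 : IsTrajectory (fun t x => -(lam k • C x t)) t₀ (fun s => φ s k) :=
      (hφ.clm_comp (PiLp.proj 2 (fun _ : Fin m => Vec d) k : Stack m d →L[ℝ] Vec d)).congr
        fun s _ => by simp [scaledBlockC]
    have h2 := (hU k).2 t₀ ht₀ _ h1 t ht
    rw [hφ0] at h2
    linarith
  have := stack_norm_le_of_forall_le (by positivity) hk
  linarith

end BlockSystem

/-! ### Robust exponential stability -/

section RobustStability

variable {X : Type*} [NormedAddCommGroup X] [NormedSpace ℝ X]

/-- The system `y' = F(t, y)` tolerates perturbations: if the velocity of `y` differs from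
`F(t, y)` by at most `ε ‖y‖ + R e^{-γ t}` with `0 < γ ≤ α`, then `y` decays like
`M (‖y(0)‖ + R) e^{-γ t}`. The horizon `T` is finite because, in the feedback interconnection to
which this is applied, the bound on the perturbation is only known up to a finite time. -/
def IsRobustlyStable (F : ℝ → X → X) (ε α M : ℝ) : Prop :=
  ∀ γ, 0 < γ → γ ≤ α → ∀ T, 0 ≤ T → ∀ R, 0 ≤ R → ∀ y h : ℝ → X,
    IsTrajectory (fun s _ => h s) 0 y →
    (∀ s ∈ Icc 0 T, ‖h s - F s (y s)‖ ≤ ε * ‖y s‖ + R * Real.exp (-γ * s)) →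
    ‖y T‖ ≤ M * (‖y 0‖ + R) * Real.exp (-γ * T)

theorem gronwall_of_integral_le {D : ℝ → ℝ} {t₀ t₁ k c : ℝ} (hk : 0 < k) (hD : Continuous D)
    (hle : ∀ t ∈ Icc t₀ t₁, D t ≤ k * (∫ s in t₀..t, D s) + c) :
    ∀ t ∈ Icc t₀ t₁, D t ≤ c * Real.exp (k * (t - t₀)) := by
  intro t ht
  have hder : ∀ x, HasDerivAt (fun t => ∫ s in t₀..t, D s) (D x) x := fun x =>
    intervalIntegral.integral_hasDerivAt_right (hD.intervalIntegrable _ _)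
      hD.aestronglyMeasurable.stronglyMeasurableAtFilter hD.continuousAt
  have h1 := le_gronwallBound_of_liminf_deriv_right_le (f := fun t => ∫ s in t₀..t, D s)
    (f' := D) (δ := 0) (K := k) (ε := c) (a := t₀) (b := t₁)
    (fun x _ => (hder x).continuousAt.continuousWithinAt)
    (fun x _ r hr => (hder x).hasDerivWithinAt.liminf_right_slope_le hr)
    (by simp) (fun x hx => hle x (Ico_subset_Icc_self hx)) t ht
  rw [gronwallBound_of_K_ne_0 hk.ne'] at h1
  refine (hle t ht).trans ?_
  have h2 := mul_le_mul_of_nonneg_left h1 hk.le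
  have h3 : k * (0 * Real.exp (k * (t - t₀)) + c / k * (Real.exp (k * (t - t₀)) - 1)) =
      c * Real.exp (k * (t - t₀)) - c := by field_simp; ring
  linarith

/-- Over one time window, a perturbed solution stays close to the solution of the nominal system
that starts at the same point. -/
theorem norm_sub_le_of_perturbed {F : ℝ → X → X} {L K ε b : ℝ} {t₀ τ : ℝ} (ht₀ : 0 ≤ t₀)
    (hL : 0 < L) (hε : 0 ≤ ε) (hε1 : ε ≤ 1)
    (hlip : ∀ t, 0 ≤ t → ∀ x x', ‖F t x - F t x'‖ ≤ L * ‖x - x'‖)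
    {y h φ : ℝ → X} (hy : IsTrajectory (fun s _ => h s) 0 y) (hφ : IsTrajectory F t₀ φ)
    (hφ0 : φ t₀ = y t₀) (hφK : ∀ s ∈ Icc t₀ (t₀ + τ), ‖φ s‖ ≤ K) (hb : 0 ≤ b)
    (hh : ∀ s ∈ Icc t₀ (t₀ + τ), ‖h s - F s (y s)‖ ≤ ε * ‖y s‖ + b)
    {t : ℝ} (ht : t ∈ Icc t₀ (t₀ + τ)) :
    ‖y t - φ t‖ ≤ (ε * K + b) * (τ * Real.exp ((L + 1) * τ)) := by
  have hτ : 0 ≤ τ := by linarith [ht.1, ht.2]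
  have hK : 0 ≤ K := (norm_nonneg _).trans (hφK t ht)
  -- a continuous function on the whole line that agrees with the distance on `[t₀, ∞)`
  let D : ℝ → ℝ := fun s => ‖y (max s t₀) - φ (max s t₀)‖
  have hmax : Continuous fun s : ℝ => max s t₀ := by fun_prop
  have hD : Continuous D := by
    refine Continuous.norm (Continuous.sub ?_ ?_)
    · exact hy.1.comp_continuous hmax fun s => ht₀.trans (le_max_right s t₀)
    · exact hφ.1.comp_continuous hmax fun s => le_max_right s t₀
  have hDe : ∀ s, t₀ ≤ s → D s = ‖y s - φ s‖ := by
    intro s hs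
    simp only [D, max_eq_left hs]
  have hle : ∀ t ∈ Icc t₀ (t₀ + τ), D t ≤ (L + 1) * (∫ s in t₀..t, D s) + (ε * K + b) * τ := by
    intro t ht
    obtain ⟨hi, hyt⟩ := hy.sub_eq_integral ht₀ ht.1
    obtain ⟨hi', hφt⟩ := hφ.2 t ht.1
    have e1 : y t - φ t = ∫ s in t₀..t, (h s - F s (φ s)) := by
      rw [intervalIntegral.integral_sub hi hi', ← hyt, hφt, hφ0]
      abel
    have hci : IntervalIntegrable (fun s => (L + 1) * D s + (ε * K + b)) volume t₀ t :=
      Continuous.intervalIntegrable (by fun_prop) _ _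
    have h1 := intervalIntegral.norm_integral_le_of_norm_le (μ := volume) (a := t₀) (b := t)
      (f := fun s => h s - F s (φ s)) (g := fun s => (L + 1) * D s + (ε * K + b)) ht.1
      (Eventually.of_forall fun s hs => by
        have hs' : s ∈ Icc t₀ (t₀ + τ) := ⟨hs.1.le, hs.2.trans ht.2⟩
        have i1 := hh s hs'
        have i2 := hlip s (ht₀.trans hs'.1) (y s) (φ s)
        have i3 := hφK s hs'
        have i4 : ‖y s‖ ≤ ‖y s - φ s‖ + ‖φ s‖ := by
          simpa using norm_add_le (y s - φ s) (φ s)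
        have i5 : ‖h s - F s (φ s)‖ ≤ ‖h s - F s (y s)‖ + ‖F s (y s) - F s (φ s)‖ := by
          simpa using norm_add_le (h s - F s (y s)) (F s (y s) - F s (φ s))
        rw [hDe s hs'.1]
        have i6 : ε * ‖y s‖ ≤ ε * (‖y s - φ s‖ + K) := by gcongr; linarith
        have i7 : ε * ‖y s - φ s‖ ≤ 1 * ‖y s - φ s‖ := by gcongr
        nlinarith) hci
    rw [hDe t ht.1, e1]
    refine h1.trans ?_
    rw [intervalIntegral.integral_add (Continuous.intervalIntegrable (by fun_prop) _ _)
      (Continuous.intervalIntegrable (by fun_prop) _ _), intervalIntegral.integral_const_mul,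
      intervalIntegral.integral_const, smul_eq_mul, mul_comm (t - t₀)]
    have : t - t₀ ≤ τ := by linarith [ht.2]
    gcongr
  have h2 := gronwall_of_integral_le (by positivity) hD hle t ht
  rw [hDe t ht.1] at h2
  refine h2.trans ?_
  rw [mul_assoc]
  have : t - t₀ ≤ τ := by linarith [ht.2]
  gcongr

/-- A nonnegative function that is halved over every window of length `τ`, up to a forcing term
`E R e^{-γ t}` and with a rate `γ` that is slow on the scale of `τ`, decays like `e^{-γ t}`. -/
theorem exp_decay_of_windows {N : ℝ → ℝ} {T τ γ K E R : ℝ} (hτ : 0 < τ) (hγ : 0 < γ)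
    (hγτ : Real.exp (γ * τ) ≤ 4 / 3) (hT : 0 ≤ T) (hK : 0 ≤ K) (hE : 0 ≤ E) (hR : 0 ≤ R)
    (hN : 0 ≤ N 0) (hfirst : ∀ t, 0 ≤ t → t ≤ τ → t ≤ T → N t ≤ (K + 1 / 4) * N 0 + E * R)
    (hstep : ∀ t, τ ≤ t → t ≤ T →
      N t ≤ 1 / 2 * N (t - τ) + E * R * Real.exp (-γ * (t - τ))) :
    N T ≤ 4 * (K + 1 + E) * (N 0 + R) * Real.exp (-γ * T) := by
  have hKN := mul_nonneg hK hN
  have hKR := mul_nonneg hK hR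
  have hER := mul_nonneg hE hR
  have hEN := mul_nonneg hE hN
  set Q := 4 * (K + 1 + E) * (N 0 + R) with hQ
  have hQ0 : 0 ≤ Q := by positivity
  have hind : ∀ n : ℕ, ∀ t, 0 ≤ t → t ≤ T → t ≤ (n + 1) * τ → N t ≤ Q * Real.exp (-γ * t) := by
    intro n
    induction n with
    | zero =>
      intro t ht htT htτ
      have htτ' : t ≤ τ := by simpa using htτ
      have h1 := hfirst t ht htτ' htT
      have h3 : 3 / 4 ≤ Real.exp (-γ * t) := by
        have h4 : Real.exp (γ * t) ≤ 4 / 3 :=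
          (Real.exp_le_exp.2 (mul_le_mul_of_nonneg_left htτ' hγ.le)).trans hγτ
        have h5 : Real.exp (-γ * t) * Real.exp (γ * t) = 1 := by
          rw [← Real.exp_add]; simp
        have h6 := mul_le_mul_of_nonneg_left h4 (Real.exp_pos (-γ * t)).le
        linarith
      have h7 : (K + 1 / 4) * N 0 + E * R ≤ Q * (3 / 4) := by
        rw [hQ]
        linarith
      exact h1.trans (h7.trans (mul_le_mul_of_nonneg_left h3 hQ0))
    | succ n ih =>
      intro t ht htT htn
      push_cast at htn
      rcases le_or_gt t τ with htτ | htτ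
      · refine ih t ht htT (htτ.trans ?_)
        linarith [mul_nonneg (Nat.cast_nonneg (α := ℝ) n) hτ.le]
      have h1 := hstep t htτ.le htT
      have h2 := ih (t - τ) (by linarith) (by linarith) (by linarith)
      have h4 : Real.exp (-γ * (t - τ)) = Real.exp (-γ * t) * Real.exp (γ * τ) := by
        rw [← Real.exp_add]; ring_nf
      have h5 : Real.exp (-γ * (t - τ)) ≤ Real.exp (-γ * t) * (4 / 3) := by
        rw [h4]
        exact mul_le_mul_of_nonneg_left hγτ (Real.exp_pos _).le
      have h6 : 0 ≤ 1 / 2 * Q + E * R := by positivity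
      have h7 : (1 / 2 * Q + E * R) * (4 / 3) ≤ Q := by
        rw [hQ]
        linarith
      have h8 := mul_le_mul_of_nonneg_left h5 h6
      have h9 := mul_le_mul_of_nonneg_right h7 (Real.exp_pos (-γ * t)).le
      linarith
  obtain ⟨n, hn⟩ := exists_nat_ge (T / τ)
  rw [div_le_iff₀ hτ] at hn
  exact hind n T hT le_rfl (by linarith)

/-- Uniform exponential stability of a Lipschitz system is robust, with a margin `ε` and constants
`α`, `M` that depend only on the stability constants `K`, `a` and on the Lipschitz constant `L`.
The time axis is cut into windows so long that the nominal system contracts by the factor `1/4`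
over each; a small perturbation leaves the factor `1/2`. -/
theorem exists_robustness_margin {K a L : ℝ} (hK : 0 < K) (ha : 0 < a) (hL : 0 < L) :
    ∃ ε₀ > 0, ∃ α > 0, ∃ M > 0, ∀ {X : Type} [NormedAddCommGroup X] [NormedSpace ℝ X]
      (F : ℝ → X → X), (∀ t, 0 ≤ t → ∀ x x', ‖F t x - F t x'‖ ≤ L * ‖x - x'‖) →
      (∀ t₀, 0 ≤ t₀ → ∀ x₀, ∃ φ, IsTrajectory F t₀ φ ∧ φ t₀ = x₀ ∧
        ∀ t, t₀ ≤ t → ‖φ t‖ ≤ K * ‖x₀‖ * Real.exp (-a * (t - t₀))) →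
      ∀ ε, 0 ≤ ε → ε ≤ ε₀ → IsRobustlyStable F ε α M := by
  set τ := Real.log (4 * K + 4) / a with hτd
  have hτ : 0 < τ := div_pos (Real.log_pos (by linarith)) ha
  have hKτ : K * Real.exp (-a * τ) ≤ 1 / 4 := by
    have e : -a * τ = -Real.log (4 * K + 4) := by rw [hτd]; field_simp
    rw [e, Real.exp_neg, Real.exp_log (by positivity), ← div_eq_mul_inv,
      div_le_div_iff₀ (by positivity) (by norm_num)]
    linarith
  set E := τ * Real.exp ((L + 1) * τ) with hE
  have hE0 : 0 < E := by positivity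
  set α := Real.log (4 / 3) / τ with hα
  have hα0 : 0 < α := div_pos (Real.log_pos (by norm_num)) hτ
  refine ⟨min 1 (1 / (4 * K * E)), by positivity, α, hα0, 4 * (K + 1 + E), by positivity, ?_⟩
  intro X _ _ F hlip hnom ε hε hεle γ hγ hγα T hT R hR y h hy hh
  have hεKE : ε * K * E ≤ 1 / 4 := by
    have h1 : ε ≤ 1 / (4 * K * E) := hεle.trans (min_le_right _ _)
    rw [le_div_iff₀ (by positivity)] at h1
    linarith
  have hγτ : Real.exp (γ * τ) ≤ 4 / 3 := by
    have h1 : γ * τ ≤ Real.log (4 / 3) := by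
      have := mul_le_mul_of_nonneg_right hγα hτ.le
      rwa [hα, div_mul_cancel₀ _ hτ.ne'] at this
    exact (Real.exp_le_exp.2 h1).trans (Real.exp_log (by norm_num)).le
  -- the basic estimate over a window that starts at `t₀`
  have hwin : ∀ t₀, 0 ≤ t₀ → ∀ t, t₀ ≤ t → t ≤ t₀ + τ → t ≤ T →
      ‖y t‖ ≤ (K * Real.exp (-a * (t - t₀)) + 1 / 4) * ‖y t₀‖ +
        E * R * Real.exp (-γ * t₀) := by
    intro t₀ ht₀ t h1 h2 h3
    obtain ⟨φ, hφ, hφ0, hφb⟩ := hnom t₀ ht₀ (y t₀)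
    have key := norm_sub_le_of_perturbed (K := K * ‖y t₀‖) (ε := ε)
      (b := R * Real.exp (-γ * t₀)) (τ := t - t₀) ht₀ hL hε (hεle.trans (min_le_left _ _)) hlip
      hy hφ hφ0 (fun s hs => by
        refine (hφb s hs.1).trans (mul_le_of_le_one_right (by positivity) ?_)
        rw [Real.exp_le_one_iff]
        nlinarith [hs.1]) (by positivity)
      (fun s hs => (hh s ⟨ht₀.trans hs.1, by linarith [hs.2]⟩).trans (by
        have : Real.exp (-γ * s) ≤ Real.exp (-γ * t₀) := Real.exp_le_exp.2 (by nlinarith [hs.1])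
        gcongr)) (t := t) ⟨h1, by linarith⟩
    have hle : (t - t₀) * Real.exp ((L + 1) * (t - t₀)) ≤ E := by
      have : t - t₀ ≤ τ := by linarith
      rw [hE]
      gcongr
    have h4 := hφb t h1
    have h5 : ‖y t‖ ≤ ‖y t - φ t‖ + ‖φ t‖ := by simpa using norm_add_le (y t - φ t) (φ t)
    have h6 := key.trans (mul_le_mul_of_nonneg_left hle (by positivity))
    have h7 := mul_le_mul_of_nonneg_right hεKE (norm_nonneg (y t₀))
    nlinarith
  refine exp_decay_of_windows (N := fun t => ‖y t‖) hτ hγ hγτ hT hK.le hE0.le hR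
    (norm_nonneg _) (fun t ht htτ htT => ?_) (fun t htτ htT => ?_)
  · have h1 := hwin 0 le_rfl t ht (by linarith) htT
    have h2 : Real.exp (-a * (t - 0)) ≤ 1 := Real.exp_le_one_iff.2 (by nlinarith)
    have h3 := mul_le_mul_of_nonneg_right (mul_le_of_le_one_right hK.le h2) (norm_nonneg (y 0))
    simp only [mul_zero, Real.exp_zero, mul_one] at h1
    linarith
  · have h1 := hwin (t - τ) (by linarith) t (by linarith) (by linarith) htT
    rw [sub_sub_cancel] at h1
    have h2 := mul_le_mul_of_nonneg_right hKτ (norm_nonneg (y (t - τ)))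
    linarith

end RobustStability

/-! ### Robustness from a Lyapunov function -/

section Lyapunov

variable {X : Type*} [NormedAddCommGroup X] [NormedSpace ℝ X] {F : ℝ → X → X} {V : X → ℝ → ℝ}
  {c₁ c₂ c₃ c₄ : ℝ}

/-- The derivative of a quadratic Lyapunov function `V` of `y' = F(t, y)` along an arbitrary curve
that is differentiable at a positive time. -/
theorem exists_hasDerivAt_lyapunov
    (hV : ContDiffOn ℝ 1 (fun p : X × ℝ => V p.1 p.2) (univ ×ˢ Ici 0)) {y : ℝ → X} {v : X} {t : ℝ}
    (ht : 0 < t) (hy : HasDerivAt y v t)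
    (hdec : derivWithin (V (y t)) (Ici 0) t + fderiv ℝ (fun z => V z t) (y t) (F t (y t)) ≤
      -c₃ * ‖y t‖ ^ 2)
    (hgrad : ‖fderiv ℝ (fun z => V z t) (y t)‖ ≤ c₄ * ‖y t‖) :
    ∃ V', HasDerivAt (fun s => V (y s) s) V' t ∧
      V' ≤ -c₃ * ‖y t‖ ^ 2 + c₄ * ‖y t‖ * ‖v - F t (y t)‖ := by
  have hn : (univ : Set (X)) ×ˢ Ici (0 : ℝ) ∈ nhds (y t, t) :=
    prod_mem_nhds univ_mem (Ici_mem_nhds ht)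
  have hW := ((hV.contDiffAt hn).differentiableAt one_ne_zero).hasFDerivAt
  set W := fderiv ℝ (fun p : X × ℝ => V p.1 p.2) (y t, t)
  have h1 : HasDerivAt (fun s => V (y s) s) (W (v, 1)) t :=
    hW.comp_hasDerivAt (f := fun s => (y s, s)) t (hy.prodMk (hasDerivAt_id t))
  have h2 : fderiv ℝ (fun z => V z t) (y t) = W.comp (ContinuousLinearMap.inl ℝ (X) ℝ) :=
    (HasFDerivAt.comp (f := fun z => (z, t)) (y t) hW (hasFDerivAt_prodMk_left (y t) t)).fderiv
  have h3 : derivWithin (V (y t)) (Ici 0) t = W (0, 1) := by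
    have : HasDerivAt (V (y t)) (W (0, 1)) t :=
      hW.comp_hasDerivAt (f := fun s => (y t, s)) t ((hasDerivAt_const t (y t)).prodMk
        (hasDerivAt_id t))
    rw [derivWithin_of_mem_nhds (Ici_mem_nhds ht), this.deriv]
  refine ⟨_, h1, ?_⟩
  set D := fderiv ℝ (fun z => V z t) (y t)
  have h4 : W (v, 1) = D v + W (0, 1) := by
    rw [h2, ContinuousLinearMap.comp_apply, ContinuousLinearMap.inl_apply, ← map_add]
    simp
  have h5 : D v = D (v - F t (y t)) + D (F t (y t)) := by
    rw [← map_add]; simp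
  have h6 : D (v - F t (y t)) ≤
      c₄ * ‖y t‖ * ‖v - F t (y t)‖ :=
    (le_abs_self _).trans ((D.le_opNorm _).trans (by gcongr))
  rw [h3] at hdec
  rw [h4, h5]
  linarith

/-- A quadratic Lyapunov function with decay constant `c₃` and gradient constant `c₄` tolerates every
perturbation with `ε c₄ < c₃`. -/
theorem exists_isRobustlyStable_of_lyapunov [CompleteSpace X] [ProperSpace X] {L : ℝ} (hL : 0 ≤ L)
    (hlip : ∀ t, 0 ≤ t → ∀ x x', ‖F t x - F t x'‖ ≤ L * ‖x - x'‖)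
    (hF0 : ∀ t, 0 ≤ t → F t 0 = 0) (h1 : 0 < c₁) (h2 : 0 < c₂) (h4 : 0 < c₄)
    (hV : ContDiffOn ℝ 1 (fun p : X × ℝ => V p.1 p.2) (univ ×ˢ Ici 0))
    (hlower : ∀ y t, 0 ≤ t → c₁ * ‖y‖ ^ 2 ≤ V y t) (hupper : ∀ y t, 0 ≤ t → V y t ≤ c₂ * ‖y‖ ^ 2)
    (hdec : ∀ y t, 0 ≤ t → derivWithin (V y) (Ici 0) t + fderiv ℝ (fun z => V z t) y (F t y) ≤
      -c₃ * ‖y‖ ^ 2)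
    (hgrad : ∀ y t, 0 ≤ t → ‖fderiv ℝ (fun z => V z t) y‖ ≤ c₄ * ‖y‖)
    {ε : ℝ} (hε : 0 ≤ ε) (hεc : ε * c₄ < c₃) :
    ∃ α > 0, ∃ M > 0, IsRobustlyStable F ε α M := by
  set c := c₃ - ε * c₄ with hc
  have hc0 : 0 < c := by linarith
  set A := c₂ + 2 * c₂ * c₄ ^ 2 / c ^ 2 with hA
  have hA0 : 0 < A := by positivity
  refine ⟨c / (8 * c₂), by positivity, Real.sqrt (A / c₁), by positivity, ?_⟩
  intro γ hγ hγα T hT R hR y h hy hh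
  obtain ⟨r, hr⟩ := isCompact_Icc.exists_bound_of_continuousOn
    (hy.1.mono (Icc_subset_Ici_self : Icc 0 T ⊆ Ici 0))
  have hB : ∀ s ∈ Icc 0 T, ‖h s‖ ≤ ε * r + R + L * r := by
    intro s hs
    have i1 := hh s hs
    have i2 := hlip s hs.1 (y s) 0
    rw [hF0 s hs.1, sub_zero, sub_zero] at i2
    have i3 : ‖h s‖ ≤ ‖h s - F s (y s)‖ + ‖F s (y s)‖ := by
      simpa only [sub_add_cancel] using
        norm_add_le (h s - F s (y s)) (F s (y s))
    have i4 := hr s hs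
    have i5 : R * Real.exp (-γ * s) ≤ R :=
      mul_le_of_le_one_right hR (Real.exp_le_one_iff.2 (by nlinarith [hs.1]))
    have i6 : ε * ‖y s‖ ≤ ε * r := by gcongr
    have i7 : L * ‖y s‖ ≤ L * r := by gcongr
    linarith
  have hac : AbsolutelyContinuousOnInterval (fun s => V (y s) s) 0 T := by
    obtain ⟨k, hk⟩ := (hV.mono (prod_mono (subset_univ (Metric.closedBall 0 r))
      (Icc_subset_Ici_self : Icc 0 T ⊆ Ici 0))).exists_lipschitzOnWith one_ne_zero
      ((convex_closedBall _ _).prod (convex_Icc _ _))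
      ((isCompact_closedBall _ _).prod isCompact_Icc)
    have hp : LipschitzOnWith (max (ε * r + R + L * r).toNNReal 1)
        (fun s => (y s, s)) (Icc 0 T) :=
      (hy.lipschitzOnWith hB).prodMk LipschitzWith.id.lipschitzOnWith
    have hcomp := hk.comp hp fun s hs =>
      ⟨by simpa [Metric.mem_closedBall] using hr s hs, hs⟩
    refine LipschitzOnWith.absolutelyContinuousOnInterval (K := k * max (ε * r + R + L * r).toNNReal 1) ?_
    rw [uIcc_of_le hT]
    exact hcomp
  have hexp : ∀ t, Real.exp (-(2 * γ) * t) = Real.exp (-γ * t) ^ 2 := fun t => by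
    rw [← Real.exp_nat_mul]; congr 1; push_cast; ring
  have key := le_exp_of_ae_deriv_le (κ := c / (2 * c₂)) (b := c₄ ^ 2 * R ^ 2 / (2 * c)) (γ := γ)
    hT hac ((by positivity : (0:ℝ) ≤ c₁ * ‖y 0‖ ^ 2).trans (hlower _ _ le_rfl)) (by positivity)
    (by
      have e : c / (2 * c₂) = 4 * (c / (8 * c₂)) := by field_simp; norm_num
      linarith) (by positivity) (by
      filter_upwards [hy.ae_hasDerivAt (T := T)] with t ht htm
      obtain ⟨V', hV', hle⟩ := exists_hasDerivAt_lyapunov hV htm.1 (ht htm)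
        (hdec _ t htm.1.le) (hgrad _ t htm.1.le)
      refine ⟨V', hV', hle.trans ?_⟩
      have i1 := hh t (Ioo_subset_Icc_self htm)
      have i2 := hupper (y t) t htm.1.le
      rw [hexp]
      set N := ‖y t‖
      set e := Real.exp (-γ * t)
      have hN : 0 ≤ N := norm_nonneg _
      have i3 : c₄ * N * ‖h t - F t (y t)‖ ≤ c₄ * N * (ε * N + R * e) := by
        gcongr
      have i4 : c / (2 * c₂) * V (y t) t ≤ c / 2 * N ^ 2 := by
        have := mul_le_mul_of_nonneg_left i2 (by positivity : 0 ≤ c / (2 * c₂))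
        refine this.trans (le_of_eq ?_)
        field_simp
      -- half of the dissipation pays for the cross term, the other half makes `V` decay
      have i5 : 0 ≤ (c * N - c₄ * R * e) ^ 2 / (2 * c) := by positivity
      have i6 : (c * N - c₄ * R * e) ^ 2 / (2 * c) =
          c / 2 * N ^ 2 - c₄ * N * (R * e) + c₄ ^ 2 * R ^ 2 / (2 * c) * e ^ 2 := by
        field_simp
        ring
      have i7 : c₃ = c + ε * c₄ := by rw [hc]; ring
      rw [i7]
      nlinarith)
  have hlow := hlower (y T) T hT
  have hup := hupper (y 0) 0 le_rfl
  refine le_of_sq_le_sq ?_ (by positivity)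
  rw [mul_pow, mul_pow, Real.sq_sqrt (by positivity), ← hexp]
  have e1 : 2 * (c₄ ^ 2 * R ^ 2 / (2 * c)) / (c / (2 * c₂)) =
      2 * c₂ * c₄ ^ 2 / c ^ 2 * R ^ 2 := by field_simp
  rw [e1] at key
  have h5 : V (y 0) 0 + 2 * c₂ * c₄ ^ 2 / c ^ 2 * R ^ 2 ≤ A * (‖y 0‖ + R) ^ 2 := by
    have j1 : 0 ≤ 2 * c₂ * c₄ ^ 2 / c ^ 2 := by positivity
    have j2 : ‖y 0‖ ^ 2 ≤ (‖y 0‖ + R) ^ 2 := by gcongr; linarith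
    have j3 : R ^ 2 ≤ (‖y 0‖ + R) ^ 2 := by gcongr; linarith [norm_nonneg (y 0)]
    rw [hA]
    nlinarith [mul_le_mul_of_nonneg_left j2 h2.le, mul_le_mul_of_nonneg_left j3 j1]
  have h6 : c₁ * ‖y T‖ ^ 2 ≤ A * (‖y 0‖ + R) ^ 2 * Real.exp (-(2 * γ) * T) :=
    hlow.trans (key.trans (by gcongr))
  rw [div_mul_eq_mul_div, div_mul_eq_mul_div, le_div_iff₀ h1]
  linarith

/-- A quadratic Lyapunov function of the block system makes it tolerate every `ε < c₃ / c₄`. -/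
theorem IsLyapunov.isRobustlyStable {m d : ℕ} {lam : Fin m → ℝ} {C : Vec d → ℝ → Vec d}
    {V : Stack m d → ℝ → ℝ} (hC : IsSST C) (hV : IsLyapunov lam C V c₁ c₂ c₃ c₄) {ε : ℝ}
    (hε : 0 ≤ ε) (hεc : ε * c₄ < c₃) :
    ∃ α > 0, ∃ M > 0, IsRobustlyStable (fun t y => -scaledBlockC lam C y t) ε α M := by
  obtain ⟨Lc, hLc, hlip⟩ := hC.lip
  have hΛ : ∀ k, |lam k| ≤ ∑ k, |lam k| := fun k =>
    Finset.single_le_sum (f := fun k => |lam k|) (fun _ _ => abs_nonneg _) (Finset.mem_univ k)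
  have hΛ0 : 0 ≤ ∑ k, |lam k| := Finset.sum_nonneg fun _ _ => abs_nonneg _
  obtain ⟨h1, h2, -, h4⟩ := hV.pos
  refine exists_isRobustlyStable_of_lyapunov (mul_nonneg hΛ0 hLc.le)
    (fun t ht x x' => neg_scaledBlockC_lipschitz hΛ0 hΛ hLc.le hlip ht x x')
    (fun t ht => by rw [hC.scaledBlockC_zero ht, neg_zero]) h1 h2 h4 hV.smooth hV.lower hV.upper
    (fun y t ht => ?_) hV.grad hε hεc
  rw [map_neg, ← sub_eq_add_neg]
  exact hV.decay y t ht

end Lyapunov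

/-! ### The small-gain argument -/

section SmallGain

variable {Y Z : Type*} [NormedAddCommGroup Y] [InnerProductSpace ℝ Y] [CompleteSpace Y]
  [NormedAddCommGroup Z] [InnerProductSpace ℝ Z] [CompleteSpace Z]

theorem IsTrajectory.exists_norm_le {W : Type*} [NormedAddCommGroup W] [NormedSpace ℝ W]
    {F : ℝ → W → W} {z : ℝ → W} (hz : IsTrajectory F 0 z) (T : ℝ) :
    ∃ r, ∀ s ∈ Icc 0 T, ‖z s‖ ≤ r :=
  isCompact_Icc.exists_bound_of_continuousOn (hz.1.mono Icc_subset_Ici_self)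

/-- A gain `β` is admissible for the interconnection if the loop gain, of order `β²`, is at most
`1/2`. The constants are those of `smallGain`. -/
def IsSmallGain (M G ν β : ℝ) : Prop :=
  6 * β ^ 2 * (1 + G + 2 * G ^ 2 / ν) * M ≤ 1

/-- Small-gain argument for a robustly stable system `y` in feedback with two stable systems `q` and
`e` whose time scales are slower by a factor `β²`. On `[0, T]` let `m` be the maximum of
`‖y(t)‖ e^{γ t}`. The energy estimates bound `e` by `O(m)` and `q` by `O(β m)`, up to initial values;
hence the perturbation of `y` is `O(β² m)`, which bounds `m` independently of `T`. -/
theorem smallGain {F : ℝ → Y → Y} {ε α M G ν β γ B : ℝ} (hF : IsRobustlyStable F ε α M)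
    (hM : 0 < M) (hG : 0 ≤ G) (hν : 0 < ν) (hβ : 0 < β) (hβs : IsSmallGain M G ν β)
    (hγ : 0 < γ) (hγα : γ ≤ α) (hγβ : 4 * γ ≤ β ^ 2) (hγν : 4 * γ ≤ β ^ 2 * ν)
    {y q hy hq : ℝ → Y} {e he : ℝ → Z}
    (ty : IsTrajectory (fun s _ => hy s) 0 y) (tq : IsTrajectory (fun s _ => hq s) 0 q)
    (te : IsTrajectory (fun s _ => he s) 0 e) (hB : 0 ≤ B)
    (bq : ∀ s, 0 ≤ s → ‖hq s‖ ≤ B * (‖q s‖ + ‖y s‖ + ‖e s‖))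
    (be : ∀ s, 0 ≤ s → ‖he s‖ ≤ B * (‖y s‖ + ‖e s‖))
    (dy : ∀ s, 0 ≤ s → ‖hy s - F s (y s)‖ ≤
      ε * ‖y s‖ + (β * ‖q s‖ + β ^ 2 * (‖y s‖ + G * (‖y s‖ + ‖e s‖))))
    (dq : ∀ s, 0 ≤ s → inner ℝ (q s) (hq s) ≤
      -β ^ 2 * ‖q s‖ ^ 2 + β ^ 3 * (‖y s‖ + G * (‖y s‖ + ‖e s‖)) * ‖q s‖)
    (de : ∀ s, 0 ≤ s → inner ℝ (e s) (he s) ≤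
      -(β ^ 2 * ν) * ‖e s‖ ^ 2 + β ^ 2 * G * ‖y s‖ * ‖e s‖) :
    ∃ A, ∀ t, 0 ≤ t → ‖y t‖ + ‖e t‖ ≤ A * Real.exp (-γ * t) := by
  -- bound on `e` in terms of a bound on `y`
  have he_le : ∀ T, 0 ≤ T → ∀ m, 0 ≤ m → (∀ s ∈ Icc 0 T, ‖y s‖ ≤ m * Real.exp (-γ * s)) →
      ‖e T‖ ≤ (‖e 0‖ + 2 * G / ν * m) * Real.exp (-γ * T) := by
    intro T hT m hm hym
    obtain ⟨ry, hry⟩ := ty.exists_norm_le T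
    obtain ⟨re, hre⟩ := te.exists_norm_le T
    have h1 := te.norm_le_exp (κ := β ^ 2 * ν) (R := β ^ 2 * G * m) (γ := γ)
      (B := B * (ry + re)) hT
      (fun s hs => (be s hs.1).trans (by have := hry s hs; have := hre s hs; gcongr))
      (by positivity) hγν (by positivity) (fun s hs => by
        refine (de s hs.1).trans (add_le_add le_rfl ?_)
        have := hym s hs
        calc β ^ 2 * G * ‖y s‖ * ‖e s‖ ≤ β ^ 2 * G * (m * Real.exp (-γ * s)) * ‖e s‖ := by gcongr
          _ = _ := by ring)
    have e1 : 2 * (β ^ 2 * G * m) / (β ^ 2 * ν) = 2 * G / ν * m := by field_simp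
    rwa [e1] at h1
  set p := 1 + G + 2 * G ^ 2 / ν with hp
  have hp0 : 0 < p := by positivity
  -- bound on `y + G (y + e)`, the forcing of both `q` and `y`
  have hforce : ∀ T, 0 ≤ T → ∀ m, 0 ≤ m → (∀ s ∈ Icc 0 T, ‖y s‖ ≤ m * Real.exp (-γ * s)) →
      ‖y T‖ + G * (‖y T‖ + ‖e T‖) ≤ (p * m + G * ‖e 0‖) * Real.exp (-γ * T) := by
    intro T hT m hm hym
    have h1 := he_le T hT m hm hym
    have h2 := hym T ⟨hT, le_rfl⟩
    calc ‖y T‖ + G * (‖y T‖ + ‖e T‖) ≤ m * Real.exp (-γ * T) + G * (m * Real.exp (-γ * T) +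
          (‖e 0‖ + 2 * G / ν * m) * Real.exp (-γ * T)) := by gcongr
      _ = _ := by rw [hp]; ring
  have hq_le : ∀ T, 0 ≤ T → ∀ m, 0 ≤ m → (∀ s ∈ Icc 0 T, ‖y s‖ ≤ m * Real.exp (-γ * s)) →
      ‖q T‖ ≤ (‖q 0‖ + 2 * β * (p * m + G * ‖e 0‖)) * Real.exp (-γ * T) := by
    intro T hT m hm hym
    obtain ⟨ry, hry⟩ := ty.exists_norm_le T
    obtain ⟨re, hre⟩ := te.exists_norm_le T
    obtain ⟨rq, hrq⟩ := tq.exists_norm_le T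
    have h1 := tq.norm_le_exp (κ := β ^ 2) (R := β ^ 3 * (p * m + G * ‖e 0‖)) (γ := γ)
      (B := B * (rq + ry + re)) hT
      (fun s hs => (bq s hs.1).trans
        (by have := hry s hs; have := hre s hs; have := hrq s hs; gcongr))
      (by positivity) hγβ (by positivity) (fun s hs => by
        refine (dq s hs.1).trans (add_le_add le_rfl ?_)
        have := hforce s hs.1 m hm fun r hr => hym r ⟨hr.1, hr.2.trans hs.2⟩
        calc β ^ 3 * (‖y s‖ + G * (‖y s‖ + ‖e s‖)) * ‖q s‖ ≤
            β ^ 3 * ((p * m + G * ‖e 0‖) * Real.exp (-γ * s)) * ‖q s‖ := by gcongr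
          _ = _ := by ring)
    have e1 : 2 * (β ^ 3 * (p * m + G * ‖e 0‖)) / β ^ 2 = 2 * β * (p * m + G * ‖e 0‖) := by
      field_simp
    rwa [e1] at h1
  set A := 2 * M * (‖y 0‖ + β * ‖q 0‖ + 3 * β ^ 2 * G * ‖e 0‖) with hA
  have hA0 : 0 ≤ A := by positivity
  have hy_le : ∀ T, 0 ≤ T → ‖y T‖ ≤ A * Real.exp (-γ * T) := by
    intro T hT
    have hc : ContinuousOn (fun t => ‖y t‖ * Real.exp (γ * t)) (Icc 0 T) := by
      have := (ty.1.mono (Icc_subset_Ici_self : Icc 0 T ⊆ Ici 0)).norm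
      fun_prop
    obtain ⟨r, hr, hmax⟩ := isCompact_Icc.exists_isMaxOn ⟨0, le_rfl, hT⟩ hc
    set m := ‖y r‖ * Real.exp (γ * r) with hm
    have hm0 : 0 ≤ m := by positivity
    have hexp : ∀ t, Real.exp (γ * t) * Real.exp (-γ * t) = 1 := fun t => by
      rw [← Real.exp_add]; simp
    have hym : ∀ s ∈ Icc 0 T, ‖y s‖ ≤ m * Real.exp (-γ * s) := by
      intro s hs
      have h1 := mul_le_mul_of_nonneg_right (hmax hs) (Real.exp_pos (-γ * s)).le
      simp only [] at h1
      rwa [mul_assoc, hexp, mul_one] at h1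
    have hyr : ∀ t ∈ Icc 0 r, ∀ s ∈ Icc 0 t, ‖y s‖ ≤ m * Real.exp (-γ * s) := fun t ht s hs =>
      hym s ⟨hs.1, hs.2.trans (ht.2.trans hr.2)⟩
    have h1 := hF γ hγ hγα r hr.1 (β * ‖q 0‖ + 3 * β ^ 2 * (p * m + G * ‖e 0‖)) (by positivity)
      y hy ty (fun s hs => by
        refine (dy s hs.1).trans (add_le_add le_rfl ?_)
        have i1 := hq_le s hs.1 m hm0 (hyr s hs)
        have i2 := hforce s hs.1 m hm0 (hyr s hs)
        calc β * ‖q s‖ + β ^ 2 * (‖y s‖ + G * (‖y s‖ + ‖e s‖)) ≤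
            β * ((‖q 0‖ + 2 * β * (p * m + G * ‖e 0‖)) * Real.exp (-γ * s)) +
              β ^ 2 * ((p * m + G * ‖e 0‖) * Real.exp (-γ * s)) := by gcongr
          _ = _ := by ring)
    have h2 : m ≤ M * (‖y 0‖ + (β * ‖q 0‖ + 3 * β ^ 2 * (p * m + G * ‖e 0‖))) := by
      have h3 := mul_le_mul_of_nonneg_right h1 (Real.exp_pos (γ * r)).le
      rwa [mul_assoc _ (Real.exp _), mul_comm (Real.exp (-γ * r)), hexp, mul_one] at h3
    have h4 : m ≤ A := by
      have h5 := mul_le_mul_of_nonneg_right (show 6 * β ^ 2 * p * M ≤ 1 from hβs) hm0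
      rw [hA]
      linarith
    refine (hym T ⟨hT, le_rfl⟩).trans (by gcongr)
  refine ⟨A + (‖e 0‖ + 2 * G / ν * A), fun t ht => ?_⟩
  have h1 := he_le t ht A hA0 fun s hs => hy_le s hs.1
  have h2 := hy_le t ht
  linarith

end SmallGain

/-! ### The Laplacian and its eigenbasis -/

section Network

variable {n : ℕ} {G : SimpleGraph (Fin n)} {w : Matrix (Fin n) (Fin n) ℝ}
  {S : Matrix (Fin n) (Fin (n - 1)) ℝ} {lam : Fin (n - 1) → ℝ}

theorem IsWeightMatrix.nonneg (hw : IsWeightMatrix G w) (i j : Fin n) : 0 ≤ w i j := by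
  by_cases h : G.Adj i j
  · exact (hw.pos i j h).le
  · exact (hw.zero i j h).ge

theorem laplacian_symm (hw : IsWeightMatrix G w) (i j : Fin n) :
    laplacian w i j = laplacian w j i := by
  by_cases h : i = j
  · rw [h]
  · simp [laplacian, h, Ne.symm h, hw.symm i j]

/-- The diagonal of `w` vanishes, so the Laplacian acts as `(L x)ᵢ = ∑ₖ wᵢₖ (xᵢ - xₖ)`. -/
theorem sum_laplacian_mul (hw : IsWeightMatrix G w) (x : Fin n → ℝ) (i : Fin n) :
    ∑ j, laplacian w i j * x j = ∑ k, w i k * (x i - x k) := by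
  have h0 : w i i = 0 := hw.zero i i (G.irrefl)
  have h1 : ∀ j, laplacian w i j * x j =
      (if i = j then (∑ k, w i k) * x i else 0) - w i j * x j := by
    intro j
    by_cases h : i = j
    · subst h; simp [laplacian, h0]
    · simp [laplacian, h]
  simp_rw [h1, Finset.sum_sub_distrib, mul_sub, Finset.sum_sub_distrib, Finset.sum_mul]
  simp

theorem sum_laplacian_col (hw : IsWeightMatrix G w) (j : Fin n) : ∑ i, laplacian w i j = 0 := by
  simp_rw [laplacian_symm hw _ j]
  simpa using sum_laplacian_mul hw (fun _ => 1) j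

theorem laplacian_quadratic_nonneg (hw : IsWeightMatrix G w) (x : Fin n → ℝ) :
    0 ≤ ∑ i, x i * ∑ j, laplacian w i j * x j := by
  have h1 : ∑ i, x i * ∑ j, laplacian w i j * x j = ∑ i, ∑ k, w i k * (x i * (x i - x k)) := by
    refine Finset.sum_congr rfl fun i _ => ?_
    rw [sum_laplacian_mul hw, Finset.mul_sum]
    exact Finset.sum_congr rfl fun k _ => by ring
  have h2 : ∑ i, ∑ k, w i k * (x i * (x i - x k)) = ∑ i, ∑ k, w i k * (x k * (x k - x i)) := by
    rw [Finset.sum_comm]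
    refine Finset.sum_congr rfl fun i _ => Finset.sum_congr rfl fun k _ => ?_
    rw [hw.symm k i]
  have h3 : 0 ≤ ∑ i, ∑ k, w i k * (x i - x k) ^ 2 :=
    Finset.sum_nonneg fun i _ => Finset.sum_nonneg fun k _ =>
      mul_nonneg (hw.nonneg i k) (sq_nonneg _)
  have h4 : ∑ i, ∑ k, w i k * (x i - x k) ^ 2 =
      ∑ i, ∑ k, w i k * (x i * (x i - x k)) + ∑ i, ∑ k, w i k * (x k * (x k - x i)) := by
    simp_rw [← Finset.sum_add_distrib]
    refine Finset.sum_congr rfl fun i _ => Finset.sum_congr rfl fun k _ => ?_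
    ring
  rw [h1]
  linarith

variable {L : Matrix (Fin n) (Fin n) ℝ}

/-- The columns of `S` are orthonormal: `Sᵀ S` is a symmetric idempotent of trace `n - 1`, so the
symmetric idempotent `1 - Sᵀ S` has trace zero and vanishes. -/
theorem IsLaplacianEigenbasis.transpose_mul_self (hS : IsLaplacianEigenbasis L S lam)
    (hn : 0 < n) : S.transpose * S = 1 := by
  have hn' : (n : ℝ) ≠ 0 := by positivity
  set P := S.transpose * S with hP
  have h1 : S.transpose * S * S.transpose = S.transpose := by
    have h2 := congrArg (fun A => S.transpose * A) hS.complete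
    simp only [Matrix.mul_one, Matrix.mul_add] at h2
    have h3 : S.transpose * Matrix.of (fun _ _ : Fin n => 1 / (n : ℝ)) = 0 := by
      ext k j
      have h4 := congrFun hS.orth k
      simp only [Matrix.mulVec, dotProduct, mul_one, Pi.zero_apply] at h4
      simp only [Matrix.mul_apply, Matrix.of_apply, ← Finset.sum_mul, h4, zero_mul,
        Matrix.zero_apply]
    rw [h3, add_zero] at h2
    rw [Matrix.mul_assoc]
    exact h2.symm
  have hPP : P * P = P := by
    rw [hP, ← Matrix.mul_assoc, h1]
  have htr : P.trace = (n : ℝ) - 1 := by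
    have h2 := congrArg Matrix.trace hS.complete
    rw [Matrix.trace_add, Matrix.trace_mul_comm] at h2
    have h3 : (Matrix.of (fun _ _ : Fin n => 1 / (n : ℝ))).trace = 1 := by
      simp [Matrix.trace, hn']
    rw [h3, Matrix.trace_one, Fintype.card_fin] at h2
    linarith
  have hsym : (1 - P).transpose = 1 - P := by
    rw [hP, Matrix.transpose_sub, Matrix.transpose_one, Matrix.transpose_mul,
      Matrix.transpose_transpose]
  have h5 : ((1 - P).transpose * (1 - P)).trace = 0 := by
    rw [hsym]
    have : (1 - P) * (1 - P) = 1 - P := by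
      rw [Matrix.sub_mul, Matrix.one_mul, Matrix.mul_sub, Matrix.mul_one, hPP, sub_self, sub_zero]
    rw [this, Matrix.trace_sub, htr, Matrix.trace_one, Fintype.card_fin, Nat.cast_sub hn]
    simp
  have h6 : 1 - P = 0 := by
    rw [← Matrix.trace_conjTranspose_mul_self_eq_zero_iff]
    simpa using h5
  exact (sub_eq_zero.1 h6).symm

theorem IsLaplacianEigenbasis.sum_mul_eq (hS : IsLaplacianEigenbasis L S lam) (i : Fin n)
    (k : Fin (n - 1)) : ∑ j, L i j * S j k = lam k * S i k := by
  have := congrFun (congrFun hS.eigen i) k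
  rw [Matrix.mul_diagonal, Matrix.mul_apply] at this
  rw [this, mul_comm]

theorem IsLaplacianEigenbasis.lam_nonneg (hw : IsWeightMatrix G w)
    (hS : IsLaplacianEigenbasis (laplacian w) S lam) (hn : 0 < n) (k : Fin (n - 1)) :
    0 ≤ lam k := by
  have h1 := laplacian_quadratic_nonneg hw (fun i => S i k)
  have h2 := congrFun (congrFun (hS.transpose_mul_self hn) k) k
  rw [Matrix.mul_apply, Matrix.one_apply_eq] at h2
  simp only [hS.sum_mul_eq, Matrix.transpose_apply] at h1 h2
  have h3 : ∑ i, S i k * (lam k * S i k) = lam k * ∑ i, S i k * S i k := by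
    rw [Finset.mul_sum]
    exact Finset.sum_congr rfl fun i _ => by ring
  rwa [h3, h2, mul_one] at h1

theorem IsLaplacianEigenbasis.abs_lam_le (hw : IsWeightMatrix G w)
    (hS : IsLaplacianEigenbasis (laplacian w) S lam) (hn : 0 < n) (k : Fin (n - 1)) :
    |lam k| ≤ lamMax lam := by
  rw [abs_of_nonneg (hS.lam_nonneg hw hn k)]
  exact le_ciSup (finite_range lam).bddAbove k

theorem IsLaplacianEigenbasis.lamMax_nonneg (hw : IsWeightMatrix G w)
    (hS : IsLaplacianEigenbasis (laplacian w) S lam) (hn : 0 < n) : 0 ≤ lamMax lam :=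
  Real.iSup_nonneg fun k => hS.lam_nonneg hw hn k

variable {d : ℕ}

/-- `Sᵀ ⊗ I_d` as a continuous linear map. -/
noncomputable def projSL {n m d : ℕ} (S : Matrix (Fin n) (Fin m) ℝ) : (Fin n → Vec d) →L[ℝ] Stack m d :=
  ((PiLp.continuousLinearEquiv 2 ℝ (fun _ : Fin m => Vec d)).symm :
    (Fin m → Vec d) →L[ℝ] Stack m d).comp
    (ContinuousLinearMap.pi fun k => ∑ i, S i k • ContinuousLinearMap.proj i)

theorem projSL_apply {m : ℕ} (S : Matrix (Fin n) (Fin m) ℝ) (x : Fin n → Vec d) :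
    projSL S x = projS S x := by
  ext1 k
  simp [projSL, projS]

/-- Decomposition of a stacked vector into its disagreement and its mean. -/
theorem IsLaplacianEigenbasis.sum_smul_projS (hS : IsLaplacianEigenbasis L S lam)
    (x : Fin n → Vec d) (i : Fin n) :
    ∑ k, S i k • projS S x k = x i - (1 / (n : ℝ)) • ∑ j, x j := by
  have h1 : ∀ j, (1 : Matrix (Fin n) (Fin n) ℝ) i j = ∑ k, S i k * S j k + 1 / (n : ℝ) := by
    intro j
    rw [congrFun (congrFun hS.complete i) j]
    simp [Matrix.mul_apply]
  have h2 : x i = ∑ j, (1 : Matrix (Fin n) (Fin n) ℝ) i j • x j := by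
    simp [Matrix.one_apply]
  rw [eq_sub_iff_add_eq]
  conv_rhs => rw [h2]
  simp_rw [h1, add_smul, Finset.sum_add_distrib, Finset.smul_sum, Finset.sum_smul, projS,
    Finset.smul_sum, smul_smul]
  rw [Finset.sum_comm]

/-- `(Sᵀ ⊗ I)(L ⊗ I) = Λ (Sᵀ ⊗ I)`. -/
theorem IsLaplacianEigenbasis.projS_laplacian (hw : IsWeightMatrix G w)
    (hS : IsLaplacianEigenbasis (laplacian w) S lam) (x : Fin n → Vec d) (k : Fin (n - 1)) :
    projS S (fun i => ∑ j, laplacian w i j • x j) k = lam k • projS S x k := by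
  simp only [projS, Finset.smul_sum, smul_smul]
  rw [Finset.sum_comm]
  refine Finset.sum_congr rfl fun j _ => ?_
  rw [← Finset.sum_smul, ← hS.sum_mul_eq]
  congr 1
  refine Finset.sum_congr rfl fun i _ => ?_
  rw [laplacian_symm hw i j, mul_comm]

end Network

/-! ### The global objective -/

section Objective

variable {n d : ℕ} {f : Fin n → Vec d → ℝ}

theorem IsAdmissibleObjective.gradient_sum (hf : IsAdmissibleObjective f) (x : Vec d) :
    gradient (fun z => ∑ i, f i z) x = ∑ i, gradient (f i) x := by
  unfold gradient
  rw [fderiv_fun_sum fun i _ => hf.diff i x, map_sum]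

/-- The global objective has a unique critical point, which is the unique solution of the
problem, and its gradient is strongly monotone. -/
theorem IsAdmissibleObjective.exists_optimal (hf : IsAdmissibleObjective f) (hn : 0 < n) :
    ∃ s : Vec d, (∀ s', IsOptimal f s' ↔ s' = s) ∧ ∑ i, gradient (f i) s = 0 ∧
      ∃ μ > 0, ∀ x, μ * ‖x - s‖ ^ 2 ≤ inner ℝ (x - s) (∑ i, gradient (f i) x) := by
  obtain ⟨μ, hμ, hstr⟩ := hf.strong
  set g : Vec d → ℝ := fun z => ∑ i, f i z with hg
  have hgd : Differentiable ℝ g := by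
    have := hf.diff
    fun_prop
  have hcoer : Tendsto g (cocompact (Vec d)) atTop := by
    set c := ‖gradient g 0‖
    have h1 : ∀ x, g 0 + (μ / 2 * ‖x‖ - c) * ‖x‖ ≤ g x := by
      intro x
      have h2 := hstr 0 x
      rw [sub_zero] at h2
      have h3 := neg_le_of_abs_le (abs_real_inner_le_norm (gradient g 0) x)
      change g 0 + inner ℝ (gradient g 0) x + μ / 2 * ‖x‖ ^ 2 ≤ g x at h2
      linarith
    refine tendsto_atTop_mono h1 (tendsto_atTop_add_const_left _ _ ?_)
    have h4 : Tendsto (fun x : Vec d => ‖x‖) (cocompact (Vec d)) atTop :=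
      tendsto_norm_cocompact_atTop
    exact (tendsto_atTop_add_const_right _ (-c) (h4.const_mul_atTop (by positivity))).atTop_mul_atTop₀
      h4
  obtain ⟨s, hs⟩ := hgd.continuous.exists_forall_le hcoer
  have hgs : gradient g s = 0 := by
    have h1 : IsLocalMin g s := Eventually.of_forall hs
    unfold gradient
    rw [h1.fderiv_eq_zero, map_zero]
  have hmin : ∀ x, g s + μ / 2 * ‖x - s‖ ^ 2 ≤ g x := by
    intro x
    have h1 := hstr s x
    change g s + inner ℝ (gradient g s) (x - s) + μ / 2 * ‖x - s‖ ^ 2 ≤ g x at h1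
    rwa [hgs, inner_zero_left, add_zero] at h1
  refine ⟨s, fun s' => ⟨fun h => ?_, ?_⟩, by rw [← hf.gradient_sum, hgs], μ, hμ, fun x => ?_⟩
  · have h1 : g s' ≤ g s := h (show (fun _ => s) ∈ {x : Fin n → Vec d | ∀ i j, x i = x j} from
      fun _ _ => rfl)
    have h2 := hmin s'
    have h3 : ‖s' - s‖ ^ 2 ≤ 0 := by nlinarith [sq_nonneg ‖s' - s‖]
    have h4 : ‖s' - s‖ = 0 := pow_eq_zero_iff two_ne_zero |>.1 (le_antisymm h3 (sq_nonneg _))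
    exact sub_eq_zero.1 (norm_eq_zero.1 h4)
  · rintro rfl x hx
    have h1 : x = fun _ => x ⟨0, hn⟩ := funext fun i => hx i _
    rw [h1]
    exact hs _
  · have h1 := hmin x
    have h2 := hstr x s
    change g x + inner ℝ (gradient g x) (s - x) + μ / 2 * ‖s - x‖ ^ 2 ≤ g s at h2
    rw [hf.gradient_sum, norm_sub_rev, ← neg_sub x s, inner_neg_right, real_inner_comm] at h2
    linarith

end Objective

/-! ### The primal-dual flow -/

section Flow

variable {n d : ℕ} {f : Fin n → Vec d → ℝ} {C : Vec d → ℝ → Vec d}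

theorem norm_sum_smul_le {ι : Type*} [Fintype ι] {X : Type*} [NormedAddCommGroup X]
    [NormedSpace ℝ X] (c : ι → ℝ) {z : ι → X} {D : ℝ} (hz : ∀ j, ‖z j‖ ≤ D) :
    ‖∑ j, c j • z j‖ ≤ (∑ j, |c j|) * D := by
  rw [Finset.sum_mul]
  refine norm_sum_le_of_le _ fun j _ => ?_
  rw [norm_smul, Real.norm_eq_abs]
  exact mul_le_mul_of_nonneg_left (hz j) (abs_nonneg _)

/-- The primal-dual flow has a global solution from every initial state. -/
theorem exists_isTrajectory_primalDualField (L : Matrix (Fin n) (Fin n) ℝ) (hC : IsSST C)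
    (hf : IsAdmissibleObjective f) {β η : ℝ} (hβ : 0 < β) (hη : 0 < η)
    (p₀ : (Fin n → Vec d) × (Fin n → Vec d)) :
    ∃ p, IsTrajectory (primalDualField L f C β η) 0 p ∧ p 0 = p₀ := by
  obtain ⟨Lc, hLc, hlip⟩ := hC.lip
  obtain ⟨Lf, hLf, hgrad⟩ := hf.lipGrad
  set A := ∑ i, ∑ j, |L i j| with hA
  have hAi : ∀ i, ∑ j, |L i j| ≤ A := fun i =>
    Finset.single_le_sum (f := fun i => ∑ j, |L i j|)
      (fun _ _ => Finset.sum_nonneg fun _ _ => abs_nonneg _) (Finset.mem_univ i)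
  have hA0 : 0 ≤ A := Finset.sum_nonneg fun _ _ => Finset.sum_nonneg fun _ _ => abs_nonneg _
  refine exists_isTrajectory (L := A * Lc + β + η * Lf + β * (A * Lc))
    (B := η * ‖fun i => gradient (f i) 0‖) (by positivity) ?_ ?_ ?_ p₀
  · intro t ht p p'
    set D := ‖p - p'‖
    have hD : 0 ≤ D := norm_nonneg _
    have h1 : ∀ j, ‖p.1 j - p'.1 j‖ ≤ D := fun j =>
      (norm_le_pi_norm (p.1 - p'.1) j).trans (norm_fst_le (p - p'))
    have h2 : ∀ j, ‖p.2 j - p'.2 j‖ ≤ D := fun j =>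
      (norm_le_pi_norm (p.2 - p'.2) j).trans (norm_snd_le (p - p'))
    have h3 : ∀ i, ‖∑ j, L i j • (C (p.1 j) t - C (p'.1 j) t)‖ ≤ A * Lc * D := by
      intro i
      refine (norm_sum_smul_le (L i) (D := Lc * D) fun j => (hlip _ _ t ht).trans
        (mul_le_mul_of_nonneg_left (h1 j) hLc.le)).trans ?_
      rw [mul_assoc]
      exact mul_le_mul_of_nonneg_right (hAi i) (by positivity)
    refine norm_prod_le_iff.2 ⟨(pi_norm_le_iff_of_nonneg (by positivity)).2 fun i => ?_,
      (pi_norm_le_iff_of_nonneg (by positivity)).2 fun i => ?_⟩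
    · have e : (primalDualField L f C β η t p - primalDualField L f C β η t p').1 i =
          -(∑ j, L i j • (C (p.1 j) t - C (p'.1 j) t)) - β • (p.2 i - p'.2 i) -
            η • (gradient (f i) (p.1 i) - gradient (f i) (p'.1 i)) := by
        simp only [primalDualField, Prod.fst_sub, Pi.sub_apply, smul_sub, Finset.sum_sub_distrib]
        abel
      rw [e]
      refine (norm_sub_le _ _).trans ((add_le_add (norm_sub_le _ _) le_rfl).trans ?_)
      rw [norm_neg, norm_smul, norm_smul, Real.norm_of_nonneg hβ.le, Real.norm_of_nonneg hη.le]
      have i1 := h3 i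
      have i2 := mul_le_mul_of_nonneg_left (h2 i) hβ.le
      have i3 := mul_le_mul_of_nonneg_left
        ((hgrad i (p.1 i) (p'.1 i)).trans (mul_le_mul_of_nonneg_left (h1 i) hLf.le)) hη.le
      have i4 : 0 ≤ β * (A * Lc) * D := by positivity
      linarith
    · have e : (primalDualField L f C β η t p - primalDualField L f C β η t p').2 i =
          β • ∑ j, L i j • (C (p.1 j) t - C (p'.1 j) t) := by
        simp only [primalDualField, Prod.snd_sub, Pi.sub_apply, smul_sub, Finset.sum_sub_distrib]
      rw [e, norm_smul, Real.norm_of_nonneg hβ.le]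
      have i1 := mul_le_mul_of_nonneg_left (h3 i) hβ.le
      have i4 : 0 ≤ (A * Lc + β + η * Lf) * D := by positivity
      linarith
  · intro t ht
    have e : primalDualField L f C β η t 0 = (-(η • fun i => gradient (f i) 0), 0) := by
      refine Prod.ext (funext fun i => ?_) (funext fun i => ?_) <;>
        simp [primalDualField, hC.apply_zero ht]
    rw [e, Prod.norm_mk, norm_neg, norm_zero, norm_smul, Real.norm_of_nonneg hη.le]
    exact max_le le_rfl (by positivity)
  · intro p hp
    have hcomp : ∀ j, AEMeasurable (fun s => C ((p s).1 j) s) (volume.restrict (Ici (0 : ℝ))) :=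
      fun j => aemeasurable_compressor_comp hC.meas hlip (by fun_prop)
    have hsum : ∀ i, AEMeasurable (fun s => ∑ j, L i j • C ((p s).1 j) s)
        (volume.restrict (Ici (0 : ℝ))) := fun i =>
      Finset.aemeasurable_fun_sum _ fun j _ => (hcomp j).const_smul (L i j)
    have hg : ∀ i, Continuous (gradient (f i)) := fun i =>
      (LipschitzWith.of_dist_le_mul (K := Lf.toNNReal) fun x x' => by
        rw [Real.coe_toNNReal _ hLf.le, dist_eq_norm, dist_eq_norm]
        exact hgrad i x x').continuous
    refine AEMeasurable.aestronglyMeasurable (AEMeasurable.prodMk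
      (aemeasurable_pi_lambda _ fun i => ?_) (aemeasurable_pi_lambda _ fun i => ?_))
    · have h1 : Continuous fun s => (p s).2 i := by fun_prop
      have h2 : Continuous fun s => gradient (f i) ((p s).1 i) := (hg i).comp (by fun_prop)
      exact ((hsum i).neg.sub (h1.measurable.aemeasurable.const_smul β)).sub
        (h2.measurable.aemeasurable.const_smul η)
    · exact (hsum i).const_smul β

section Coordinates

variable {X Y : Type*} [NormedAddCommGroup X] [NormedSpace ℝ X] [CompleteSpace X]
  [NormedAddCommGroup Y] [NormedSpace ℝ Y] [CompleteSpace Y]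

/-- Affine images of a trajectory. -/
theorem IsTrajectory.clm_add_const (A : X →L[ℝ] Y) (c : Y) {F : ℝ → X → X} {p : ℝ → X} {k : ℝ → Y}
    (hp : IsTrajectory F 0 p) (hk : ∀ t, 0 ≤ t → A (F t (p t)) = k t) :
    IsTrajectory (fun t _ => k t) 0 (fun t => A (p t) + c) := by
  have h1 : IsTrajectory (fun t _ => k t) 0 (fun t => A (p t)) := (hp.clm_comp A).congr hk
  refine ⟨h1.1.add continuousOn_const, fun t ht => ⟨(h1.2 t ht).1, ?_⟩⟩
  have h2 := (h1.2 t ht).2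
  simp only [] at h2 ⊢
  rw [h2]
  abel

theorem IsTrajectory.fst_add_const (A : X →L[ℝ] Y) (c : Y) {F : ℝ → X × X → X × X} {p : ℝ → X × X}
    {k : ℝ → Y} (hp : IsTrajectory F 0 p) (hk : ∀ t, 0 ≤ t → A (F t (p t)).1 = k t) :
    IsTrajectory (fun t _ => k t) 0 (fun t => A (p t).1 + c) :=
  hp.clm_add_const (A.comp (ContinuousLinearMap.fst ℝ X X)) c hk

theorem IsTrajectory.snd_add_smul_fst_add_const (A : X →L[ℝ] Y) (β : ℝ) (c : Y)
    {F : ℝ → X × X → X × X} {p : ℝ → X × X} {k : ℝ → Y} (hp : IsTrajectory F 0 p)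
    (hk : ∀ t, 0 ≤ t → A (F t (p t)).2 + β • A (F t (p t)).1 = k t) :
    IsTrajectory (fun t _ => k t) 0 (fun t => A (p t).2 + β • A (p t).1 + c) :=
  hp.clm_add_const (A.comp (ContinuousLinearMap.snd ℝ X X) +
    β • A.comp (ContinuousLinearMap.fst ℝ X X)) c hk

/-- The velocity of the combination of dual error and disagreement: the compressed term `a`
cancels. -/
theorem dual_velocity_eq {E : Type*} [AddCommGroup E] [Module ℝ E] (β : ℝ) (a b c y g : E) :
    β • a + β • (-a - β • b - β ^ 2 • c) =
      -(β ^ 2 • (b + β • y + β • g)) + β ^ 3 • (y - (c - g)) := by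
  module

theorem primal_velocity_sub_eq {E : Type*} [AddCommGroup E] [Module ℝ E] (β : ℝ)
    (a b c y g z : E) :
    (-a - β • b - β ^ 2 • c) - -z =
      (z - a) + (-(β • (b + β • y + β • g)) + β ^ 2 • (y - (c - g))) := by
  module

end Coordinates

variable {G : SimpleGraph (Fin n)} {w : Matrix (Fin n) (Fin n) ℝ}
  {S : Matrix (Fin n) (Fin (n - 1)) ℝ} {lam : Fin (n - 1) → ℝ}

/-- The mean of a stacked vector. -/
noncomputable def meanL (n d : ℕ) : (Fin n → Vec d) →L[ℝ] Vec d :=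
  (1 / (n : ℝ)) • ∑ i, ContinuousLinearMap.proj i

theorem meanL_apply (x : Fin n → Vec d) : meanL n d x = (1 / (n : ℝ)) • ∑ i, x i := by
  simp [meanL]

/-- Along the flow the sum of the dual variables is preserved. -/
theorem sum_dual_eq_zero (hw : IsWeightMatrix G w) {β η : ℝ}
    {p : ℝ → (Fin n → Vec d) × (Fin n → Vec d)}
    (hp : IsTrajectory (primalDualField (laplacian w) f C β η) 0 p)
    (hp0 : ∑ i, (p 0).2 i = 0) {t : ℝ} (ht : 0 ≤ t) : ∑ i, (p t).2 i = 0 := by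
  let A : (Fin n → Vec d) × (Fin n → Vec d) →L[ℝ] Vec d :=
    (∑ i, ContinuousLinearMap.proj i).comp (ContinuousLinearMap.snd ℝ _ _)
  have hA : ∀ q, A q = ∑ i, q.2 i := fun q => by simp [A]
  have h1 := ((hp.clm_comp A).2 t ht).2
  have h2 : ∀ s, A (primalDualField (laplacian w) f C β η s (p s)) = 0 := by
    intro s
    rw [hA]
    simp only [primalDualField, ← Finset.smul_sum]
    rw [Finset.sum_comm]
    simp_rw [← Finset.sum_smul, sum_laplacian_col hw]
    simp
  simp_rw [h2, hA, hp0] at h1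
  simpa using h1

/-- The disagreement and the error of the mean control every agent. -/
theorem IsLaplacianEigenbasis.norm_sub_mean_le {L : Matrix (Fin n) (Fin n) ℝ}
    (hS : IsLaplacianEigenbasis L S lam) (x : Fin n → Vec d) (i : Fin n) :
    ‖x i - meanL n d x‖ ≤ (∑ i, ∑ k, |S i k|) * ‖projSL S x‖ := by
  rw [meanL_apply, ← hS.sum_smul_projS, projSL_apply]
  refine (norm_sum_smul_le _ fun k => PiLp.norm_apply_le (projS S x) k).trans ?_
  refine mul_le_mul_of_nonneg_right ?_ (norm_nonneg _)
  exact Finset.single_le_sum (f := fun i => ∑ k, |S i k|)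
    (fun _ _ => Finset.sum_nonneg fun _ _ => abs_nonneg _) (Finset.mem_univ i)

/-- `Λ C̄(Sᵀ x)` is close to `Sᵀ L 𝒞(x)` when the compressor almost commutes with `Sᵀ`. -/
theorem AlmostCommutes.norm_scaledBlockC_sub_le (hn : 0 < n) (hw : IsWeightMatrix G w)
    (hS : IsLaplacianEigenbasis (laplacian w) S lam) {δ : ℝ} (hcom : AlmostCommutes C S δ)
    (x : Fin n → Vec d) {t : ℝ} (ht : 0 ≤ t) :
    ‖scaledBlockC lam C (projSL S x) t -
      projSL S (fun i => ∑ j, laplacian w i j • C (x j) t)‖ ≤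
      lamMax lam * δ * ‖projSL S x‖ := by
  have h1 := stack_norm_le_of_forall_le (c := lamMax lam) (hS.lamMax_nonneg hw hn)
    (z := scaledBlockC lam C (projSL S x) t -
      projSL S (fun i => ∑ j, laplacian w i j • C (x j) t))
    (w := blockC C (projS S x) t - projS S (fun i => C (x i) t)) (fun k => by
      have e : (scaledBlockC lam C (projSL S x) t -
          projSL S (fun i => ∑ j, laplacian w i j • C (x j) t)) k =
          lam k • (blockC C (projS S x) t - projS S (fun i => C (x i) t)) k := by
        rw [PiLp.sub_apply, PiLp.sub_apply, projSL_apply, projSL_apply,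
          hS.projS_laplacian hw (fun j => C (x j) t), smul_sub]
        rfl
      rw [e, norm_smul, Real.norm_eq_abs]
      exact mul_le_mul_of_nonneg_right (hS.abs_lam_le hw hn k) (norm_nonneg _))
  have h2 := mul_le_mul_of_nonneg_left (hcom x t ht) (hS.lamMax_nonneg hw hn)
  rw [projSL_apply] at h1 ⊢
  linarith

/-- If the averaged disagreement dynamics `y' = -Λ C̄(y, t)` tolerate relative perturbations of size
`λₙ δ`, then the flow solves the problem for small gains `β` and `η = β²`. The disagreement
`y = Sᵀ x`, the combination `q = Sᵀ (v - v*) + β y` of the dual error with the disagreement (its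
velocity is free of the compressor), and the error `e` of the mean form the interconnection of
`smallGain`. -/
theorem solvedByFlow_of_isRobustlyStable (hn : 0 < n) (hw : IsWeightMatrix G w)
    (hS : IsLaplacianEigenbasis (laplacian w) S lam) (hC : IsSST C) {δ α M : ℝ}
    (hcom : AlmostCommutes C S δ) (hα : 0 < α) (hM : 0 < M)
    (hR : IsRobustlyStable (fun t y => -scaledBlockC lam C y t) (lamMax lam * δ) α M)
    (hf : IsAdmissibleObjective f) : SolvedByFlow (laplacian w) f C := by
  have hn' : (0 : ℝ) < n := by exact_mod_cast hn
  obtain ⟨s, hs, hcrit, μ, hμ, hmono⟩ := hf.exists_optimal hn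
  obtain ⟨Lf, hLf, hgrad⟩ := hf.lipGrad
  set A := ∑ i, ∑ k, |S i k|
  have hA0 : 0 ≤ A := Finset.sum_nonneg fun _ _ => Finset.sum_nonneg fun _ _ => abs_nonneg _
  set P : (Fin n → Vec d) →L[ℝ] Stack (n - 1) d := projSL S
  set Γ := (‖P‖ + 1) * (Lf * (A + 1)) with hΓ
  have hΓ0 : 0 ≤ Γ := by positivity
  have hΓ1 : Lf * (A + 1) ≤ Γ := le_mul_of_one_le_left (by positivity) (by simp)
  have hΓ2 : ‖P‖ * (Lf * (A + 1)) ≤ Γ := by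
    rw [hΓ]
    gcongr
    simp
  set ν := μ / n with hν
  have hν0 : 0 < ν := by positivity
  set β := Real.sqrt (1 / (6 * (1 + Γ + 2 * Γ ^ 2 / ν) * M)) with hβ
  have hβ0 : 0 < β := by positivity
  have hsmall : IsSmallGain M Γ ν β := by
    unfold IsSmallGain
    rw [hβ, Real.sq_sqrt (by positivity)]
    apply le_of_eq
    have : (1 + Γ + 2 * Γ ^ 2 / ν) ≠ 0 := by positivity
    field_simp
  clear_value β Γ
  set γ := min α (min (β ^ 2 / 4) (β ^ 2 * ν / 4)) with hγ
  have hγ0 : 0 < γ := by positivity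
  refine ⟨s, hs, β, hβ0, β ^ 2, by positivity, 2 * γ, by positivity, fun x₀ v₀ _ =>
    exists_isTrajectory_primalDualField _ hC hf hβ0 (by positivity) (x₀, v₀), fun p hp hp0 => ?_⟩
  let g : (Fin n → Vec d) → (Fin n → Vec d) := fun x i => gradient (f i) (x i)
  let LC : ℝ → (Fin n → Vec d) := fun t i => ∑ j, laplacian w i j • C ((p t).1 j) t
  have hfield : ∀ t, primalDualField (laplacian w) f C β (β ^ 2) t (p t) =
      (-LC t - β • (p t).2 - β ^ 2 • g (p t).1, β • LC t) := fun t => rfl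
  let y : ℝ → Stack (n - 1) d := fun t => P (p t).1
  let q : ℝ → Stack (n - 1) d := fun t => (P (p t).2 + β • P (p t).1) + β • P (g fun _ => s)
  let e : ℝ → Vec d := fun t => meanL n d (p t).1 + -s
  let D : ℝ → Stack (n - 1) d := fun t => P (g (p t).1) - P (g fun _ => s)
  have hmap : ∀ a b c : Fin n → Vec d, P (-a - β • b - β ^ 2 • c) =
      -P a - β • P b - β ^ 2 • P c := fun a b c => by
    rw [map_sub, map_sub, map_neg, map_smul, map_smul]
  have ty : IsTrajectory (fun t _ => -P (LC t) - β • P (p t).2 - β ^ 2 • P (g (p t).1)) 0 y :=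
    (hp.clm_comp (P.comp (ContinuousLinearMap.fst ℝ _ _))).congr fun t _ => hmap _ _ _
  have tq : IsTrajectory (fun t _ => -(β ^ 2 • q t) + β ^ 3 • (y t - D t)) 0 q :=
    hp.snd_add_smul_fst_add_const P β (β • P (g fun _ => s)) fun t _ => by
      rw [hfield, hmap, map_smul]
      exact dual_velocity_eq β _ _ _ _ _
  have te : IsTrajectory (fun t _ => -((β ^ 2 / n) • ∑ i, g (p t).1 i)) 0 e := by
    refine hp.fst_add_const (meanL n d) (-s) fun t ht => ?_
    have h1 : ∑ i, LC t i = 0 := by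
      simp only [LC]
      rw [Finset.sum_comm]
      simp_rw [← Finset.sum_smul, sum_laplacian_col hw]
      simp
    have h2 := sum_dual_eq_zero hw hp hp0 ht
    rw [hfield, meanL_apply]
    simp only [Pi.sub_apply, Pi.neg_apply, Pi.smul_apply, Finset.sum_sub_distrib,
      Finset.sum_neg_distrib, ← Finset.smul_sum, h1, h2]
    rw [neg_zero, smul_zero, sub_zero, zero_sub, smul_neg, smul_smul, one_div_mul_eq_div]
  have hxm : ∀ t i, ‖(p t).1 i - (s + e t)‖ ≤ A * ‖y t‖ := by
    intro t i
    have : s + e t = meanL n d (p t).1 := by simp only [e]; abel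
    rw [this]
    exact hS.norm_sub_mean_le _ i
  have hxs : ∀ t i, ‖(p t).1 i - s‖ ≤ (A + 1) * (‖y t‖ + ‖e t‖) := by
    intro t i
    have h1 : (p t).1 i - s = ((p t).1 i - (s + e t)) + e t := by abel
    have h2 := norm_add_le ((p t).1 i - (s + e t)) (e t)
    rw [← h1] at h2
    have h3 : 0 ≤ A * ‖e t‖ := by positivity
    linarith [hxm t i, norm_nonneg (y t)]
  have hg : ∀ t i, ‖g (p t).1 i - gradient (f i) s‖ ≤ Lf * (A + 1) * (‖y t‖ + ‖e t‖) := by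
    intro t i
    refine (hgrad i _ _).trans ?_
    rw [mul_assoc]
    exact mul_le_mul_of_nonneg_left (hxs t i) hLf.le
  have hD : ∀ t, ‖D t‖ ≤ Γ * (‖y t‖ + ‖e t‖) := by
    intro t
    simp only [D, ← map_sub]
    have h1 : ‖g (p t).1 - g fun _ => s‖ ≤ Lf * (A + 1) * (‖y t‖ + ‖e t‖) :=
      (pi_norm_le_iff_of_nonneg (by positivity)).2 fun i => hg t i
    refine (P.le_opNorm _).trans ((mul_le_mul_of_nonneg_left h1 (norm_nonneg _)).trans ?_)
    rw [← mul_assoc]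
    exact mul_le_mul_of_nonneg_right hΓ2 (by positivity)
  have hyD : ∀ t, ‖y t - D t‖ ≤ ‖y t‖ + Γ * (‖y t‖ + ‖e t‖) := fun t =>
    (norm_sub_le _ _).trans (add_le_add le_rfl (hD t))
  obtain ⟨c, hc⟩ := smallGain (B := β ^ 2 + β ^ 3 + β ^ 3 * Γ + β ^ 2 * Γ) hR hM hΓ0 hν0 hβ0 hsmall
    hγ0 (min_le_left _ _)
    (by linarith [min_le_left (β ^ 2 / 4) (β ^ 2 * ν / 4),
      min_le_right α (min (β ^ 2 / 4) (β ^ 2 * ν / 4))])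
    (by linarith [min_le_right (β ^ 2 / 4) (β ^ 2 * ν / 4),
      min_le_right α (min (β ^ 2 / 4) (β ^ 2 * ν / 4))]) ty tq te (by positivity)
    (fun t _ => by
      refine (norm_add_le _ _).trans ?_
      rw [norm_neg, norm_smul, norm_smul, Real.norm_of_nonneg (by positivity),
        Real.norm_of_nonneg (by positivity)]
      have h1 := mul_le_mul_of_nonneg_left (hyD t) (by positivity : 0 ≤ β ^ 3)
      have h2 : 0 ≤ (β ^ 3 + β ^ 3 * Γ + β ^ 2 * Γ) * ‖q t‖ := by positivity
      have h3 : 0 ≤ (β ^ 2 + β ^ 2 * Γ) * ‖y t‖ := by positivity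
      have h4 : 0 ≤ (β ^ 2 + β ^ 3 + β ^ 2 * Γ) * ‖e t‖ := by positivity
      linarith)
    (fun t _ => by
      have h1 : ∑ i, g (p t).1 i = ∑ i, (g (p t).1 i - gradient (f i) s) := by
        rw [Finset.sum_sub_distrib, hcrit, sub_zero]
      have h2 : ‖∑ i, (g (p t).1 i - gradient (f i) s)‖ ≤
          n * (Lf * (A + 1) * (‖y t‖ + ‖e t‖)) := by
        refine (norm_sum_le_of_le _ fun i _ => hg t i).trans ?_
        simp
      rw [norm_neg, norm_smul, Real.norm_of_nonneg (by positivity), h1]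
      have h3 := mul_le_mul_of_nonneg_left h2 (by positivity : 0 ≤ β ^ 2 / n)
      have h4 : β ^ 2 / n * (n * (Lf * (A + 1) * (‖y t‖ + ‖e t‖))) =
          β ^ 2 * ((Lf * (A + 1)) * (‖y t‖ + ‖e t‖)) := by field_simp
      have h5 : β ^ 2 * ((Lf * (A + 1)) * (‖y t‖ + ‖e t‖)) ≤
          β ^ 2 * (Γ * (‖y t‖ + ‖e t‖)) := by gcongr
      have h6 : 0 ≤ (β ^ 2 + β ^ 3 + β ^ 3 * Γ) * (‖y t‖ + ‖e t‖) := by positivity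
      linarith)
    (fun t ht => by
      have h1 : -P (LC t) - β • P (p t).2 - β ^ 2 • P (g (p t).1) - -scaledBlockC lam C (y t) t =
          (scaledBlockC lam C (y t) t - P (LC t)) + (-(β • q t) + β ^ 2 • (y t - D t)) :=
        primal_velocity_sub_eq β _ _ _ _ _ _
      rw [h1]
      refine (norm_add_le _ _).trans (add_le_add (hcom.norm_scaledBlockC_sub_le hn hw hS _ ht)
        ((norm_add_le _ _).trans ?_))
      rw [norm_neg, norm_smul, norm_smul, Real.norm_of_nonneg (by positivity),
        Real.norm_of_nonneg (by positivity)]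
      have := hyD t
      gcongr)
    (fun t _ => by
      rw [inner_add_right, inner_neg_right, real_inner_smul_right, real_inner_smul_right,
        real_inner_self_eq_norm_sq]
      have h1 := (real_inner_le_norm (q t) (y t - D t)).trans
        (mul_le_mul_of_nonneg_left (hyD t) (norm_nonneg _))
      have h2 := mul_le_mul_of_nonneg_left h1 (by positivity : 0 ≤ β ^ 3)
      linarith)
    (fun t _ => by
      have h1 := hmono (s + e t)
      rw [add_sub_cancel_left] at h1
      have h2 : ‖∑ i, (g (p t).1 i - gradient (f i) (s + e t))‖ ≤ n * (Lf * (A * ‖y t‖)) := by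
        refine (norm_sum_le_of_le _ fun i _ => (hgrad i _ _).trans
          (mul_le_mul_of_nonneg_left (hxm t i) hLf.le)).trans ?_
        simp
      have h3 : ∑ i, g (p t).1 i = ∑ i, gradient (f i) (s + e t) +
          ∑ i, (g (p t).1 i - gradient (f i) (s + e t)) := by
        rw [Finset.sum_sub_distrib]; abel
      have h4 := neg_le_of_abs_le ((abs_real_inner_le_norm (e t)
        (∑ i, (g (p t).1 i - gradient (f i) (s + e t)))).trans
        (mul_le_mul_of_nonneg_left h2 (norm_nonneg _)))
      rw [inner_neg_right, real_inner_smul_right, h3, inner_add_right]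
      have h5 := mul_le_mul_of_nonneg_left (add_le_add h1 h4) (by positivity : 0 ≤ β ^ 2 / n)
      have h6 : β ^ 2 / n * (μ * ‖e t‖ ^ 2 + -(‖e t‖ * (n * (Lf * (A * ‖y t‖))))) =
          β ^ 2 * ν * ‖e t‖ ^ 2 - β ^ 2 * (Lf * A) * ‖y t‖ * ‖e t‖ := by
        rw [hν]; field_simp; ring
      have h7 : β ^ 2 * (Lf * A) * ‖y t‖ * ‖e t‖ ≤ β ^ 2 * Γ * ‖y t‖ * ‖e t‖ := by
        have : Lf * A ≤ Γ := by linarith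
        gcongr
      linarith)
  intro i
  refine IsBigO.of_bound (((A + 1) * c) ^ 2) ?_
  filter_upwards [eventually_ge_atTop 0] with t ht
  have h1 : ‖(p t).1 i - s‖ ≤ (A + 1) * c * Real.exp (-γ * t) := by
    refine (hxs t i).trans ?_
    rw [mul_assoc]
    exact mul_le_mul_of_nonneg_left (hc t ht) (by positivity)
  have h2 : Real.exp (-(2 * γ) * t) = Real.exp (-γ * t) ^ 2 := by
    rw [← Real.exp_nat_mul]; congr 1; push_cast; ring
  rw [Real.norm_of_nonneg (by positivity), Real.norm_of_nonneg (by positivity), h2, ← mul_pow]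
  exact pow_le_pow_left₀ (norm_nonneg _) h1 2

end Flow

theorem theorem3 {n d : ℕ} (G : SimpleGraph (Fin n)) (hG : G.Connected)
    (w : Matrix (Fin n) (Fin n) ℝ) (hw : IsWeightMatrix G w)
    (S : Matrix (Fin n) (Fin (n - 1)) ℝ) (lam : Fin (n - 1) → ℝ)
    (hS : IsLaplacianEigenbasis (laplacian w) S lam) :
    -- the explicit threshold `δ < c₃ / (c₄ λₙ)`, for every Lyapunov function
    (∀ C : Vec d → ℝ → Vec d, IsSST C →
      ∀ (V : Stack (n - 1) d → ℝ → ℝ) (c₁ c₂ c₃ c₄ : ℝ), IsLyapunov lam C V c₁ c₂ c₃ c₄ →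
      ∀ δ : ℝ, 0 < δ → δ * (c₄ * lamMax lam) < c₃ → AlmostCommutes C S δ →
      ∀ f : Fin n → Vec d → ℝ, IsAdmissibleObjective f → SolvedByFlow (laplacian w) f C) ∧
    -- a threshold that depends on the network and the constants of the compressor alone
    (∀ K a Lc : ℝ, 0 < K → 0 < a → 0 < Lc → ∃ δ₀ > 0,
      ∀ C : Vec d → ℝ → Vec d, IsSST C → IsLipschitzInSpace C Lc →
      (∀ k, IsUGESWith (fun t x => -(lam k • C x t)) K a) →
      ∀ δ : ℝ, 0 < δ → δ < δ₀ → AlmostCommutes C S δ →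
      ∀ f : Fin n → Vec d → ℝ, IsAdmissibleObjective f → SolvedByFlow (laplacian w) f C) := by
  have hn : 0 < n := Fin.pos_iff_nonempty.2 hG.nonempty
  have hΛ := hS.lamMax_nonneg hw hn
  refine ⟨?_, ?_⟩
  · intro C hC V c₁ c₂ c₃ c₄ hV δ hδ hδc hcom f hf
    obtain ⟨α, hα, M, hM, hR⟩ := hV.isRobustlyStable hC (ε := lamMax lam * δ) (by positivity)
      (by linarith)
    exact solvedByFlow_of_isRobustlyStable hn hw hS hC hcom hα hM hR hf
  · intro K a Lc hK ha hLc
    obtain ⟨ε₀, hε₀, α, hα, M, hM, hmargin⟩ :=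
      exists_robustness_margin hK ha (by positivity : 0 < lamMax lam * Lc + 1)
    refine ⟨ε₀ / (lamMax lam + 1), by positivity, ?_⟩
    intro C hC hlip hU δ hδ hδ₀ hcom f hf
    rw [lt_div_iff₀ (by positivity)] at hδ₀
    refine solvedByFlow_of_isRobustlyStable hn hw hS hC hcom hα hM (hmargin _ ?_ ?_ _
      (by positivity) (by linarith)) hf
    · intro t ht x x'
      refine (neg_scaledBlockC_lipschitz hΛ (hS.abs_lam_le hw hn) hLc.le hlip ht x x').trans ?_
      linarith [norm_nonneg (x - x')]
    · intro t₀ ht₀ x₀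
      exact exists_isTrajectory_scaledBlockC hC hK.le hU ht₀ x₀
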